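/- **Theorem.** Consider the class of $(1+1)$-dimensional linear Schrödinger equations $$\mathcal L_V:\quad i\psi_t+\psi_{xx}+V(t,x)\psi=0,$$ where $\psi$ is a complex-valued unknown function of the real variables $t,x$ and $V$ is a smooth complex-valued potential, defined on an open subset $\operatorname{dom}V$ of the $(t,x)$-plane. A *point transformation* is a smooth map $\varphi:(t,x,\psi)\mapsto(\tilde t,\tilde x,\tilde\psi)$, $\tilde t=T(t,x,\psi,\psi^*)$, $\tilde x=X(t,x,\psi,\psi^*)$, $\tilde\psi=\Psi(t,x,\psi,\psi^*)$, defined on a nonempty open set $\Omega\subset\mathbb R\times\mathbb R\times\mathbb C$, with $dT\wedge dX\wedge d\Psi\wedge d\Psi^*\neq0$ on $\Omega$. The *equivalence groupoid* $\mathcal G^\sim$ of the class is the set of all triples $(V,\tilde V,\varphi)$ such that $\operatorname{dom}V$ contains the projection of $\Omega$ to the $(t,x)$-plane, $\operatorname{dom}\tilde V$ contains the projection of $\varphi(\Omega)$ to the $(\tilde t,\tilde x)$-plane, and $\varphi$ maps $\mathcal L_V$ to $\mathcal L_{\tilde V}$, i.e., at every second-order jet over $\Omega$ at which the second prolongation of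 $\varphi$ is defined, the jet satisfies $\mathcal L_V$ if and only if its image satisfies $\mathcal L_{\tilde V}$. For an open set $N\subset\Omega$ we say that $(V,\tilde V,\varphi)$ *has the standard form on $N$* if there are smooth real-valued functions $T,X^0,\Sigma,\Upsilon$ of $t$, defined on the projection of $N$ to the $t$-axis, with $T_t\ne0$, a sign $\varepsilon=\pm1$ and a smooth solution $\Phi=\Phi(t,x)$ of $\mathcal L_V$ on the projection of $N$ to the $(t,x)$-plane such that on $N$ $$\tilde t=T,\qquad \tilde x=\varepsilon|T_t|^{1/2}x+X^0,$$ $$\tilde\psi=\exp\left(\frac i8\frac{T_{tt}}{|T_t|}x^2+\frac i2\frac{\varepsilon\varepsilon'X^0_t}{|T_t|^{1/2}}x+i\Sigma+\Upsilon\right)(\hat\psi+\hat\Phi),$$ $$\tilde V=\frac{\hat V}{|T_t|}+\frac{2T_{ttt}T_t-3T_{tt}^{\,2}}{16\varepsilon'T_t^{\,3}}x^2+\frac{\varepsilon\varepsilon'}{2|T_t|^{1/2}}\left(\frac{X^0_t}{T_t}\right)_{t}x-\frac{iT_{tt}+(X^0_t)^2}{4T_t^{\,2}}+\frac{\Sigma_t-i\Upsilon_t}{T_t},$$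 where $\tilde V$ is evaluated at $(\tilde t,\tilde x)$, $V$ at $(t,x)$, $\varepsilon'=\operatorname{sgn}T_t$, and $\hat\beta=\beta$ if $T_t>0$, $\hat\beta=\beta^*$ (complex conjugate) if $T_t<0$. Then: 1. If $\Omega$, all its slices $t=\mathrm{const}$ and all its fibres $(t,x)=\mathrm{const}$ are connected (or empty), then $(V,\tilde V,\varphi)\in\mathcal G^\sim$ if and only if $(V,\tilde V,\varphi)$ has the standard form on the whole of $\Omega$. 2. For an arbitrary domain $\Omega$, $(V,\tilde V,\varphi)\in\mathcal G^\sim$ if and only if every point of $\Omega$ has an open neighbourhood $N\subset\Omega$ on which $(V,\tilde V,\varphi)$ has the standard form. 3. The potential $V$ and the parameters are arbitrary: for every potential $V$, every nonempty connected open $\Omega$ whose projection to the $(t,x)$-plane lies in $\operatorname{dom}V$, and all $T,X^0,\Sigma,\Upsilon,\varepsilon,\Phi$ as above (with $N=\Omega$), the formulas for $(\tilde t,\tilde x,\tilde\psi)$ define a point transformation $\varphi$ on $\Omega$, and there is a potential $\tilde V$ satisfying the formula above, with $(V,\tilde V,\varphi)\in\mathcal G^\sim$. -/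

import Mathlib

open scoped ContDiff Topology

noncomputable section

namespace LinSch

/-- The space of the independent variables `(t, x)`. -/
abbrev Base : Type := ℝ × ℝ

/-- The space of the variables `((t, x), ψ)`, regarded as a real vector space. -/
abbrev Total : Type := Base × ℂ

/-- Partial derivative with respect to `t`. -/
def dt (u : Base → ℂ) (p : Base) : ℂ := fderiv ℝ u p (1, 0)

/-- Partial derivative with respect to `x`. -/
def dx (u : Base → ℂ) (p : Base) : ℂ := fderiv ℝ u p (0, 1)

/-- A smooth complex-valued potential, defined on an open subset of the `(t, x)`-plane. -/
structure Potential where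
  dom : Set Base
  isOpen_dom : IsOpen dom
  toFun : Base → ℂ
  smooth : ContDiffOn ℝ ∞ toFun dom

/-- The left-hand side `i u_t + u_xx + V u` of the Schrödinger equation with potential `V`. -/
def Potential.lhs (V : Potential) (u : Base → ℂ) (p : Base) : ℂ :=
  Complex.I * dt u p + dx (dx u) p + V.toFun p * u p

/-- `u` is a smooth solution of the Schrödinger equation with potential `V` on `D`. -/
def Potential.IsSolutionOn (V : Potential) (u : Base → ℂ) (D : Set Base) : Prop :=
  ContDiffOn ℝ ∞ u D ∧ ∀ p ∈ D, V.lhs u p = 0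

/-- A (locally invertible) point transformation: a smooth map from a nonempty open subset of the
`(t, x, ψ)`-space to this space whose real Jacobian is nowhere degenerate, that is,
`dT ∧ dX ∧ dΨ ∧ dΨ* ≠ 0`. -/
structure PointTransformation where
  source : Set Total
  isOpen_source : IsOpen source
  nonempty_source : source.Nonempty
  toFun : Total → Total
  smooth : ContDiffOn ℝ ∞ toFun source
  nondegenerate : ∀ z ∈ source, Function.Bijective (fderiv ℝ toFun z)

/-- `φ` maps the equation with potential `V` to the equation with potential `W`, in the usual
jet-space sense: the second prolongation of `φ` identifies the submanifold of the second-order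
jet space given by the first equation with the one given by the second equation.

A 2-jet over a point of the source is represented by the germ at `p` of a smooth function `u`; its
image under the prolongation is represented by a germ `v` whose graph is the image under `φ` of
the graph of `u`. The prolongation is defined at this jet when the image of the graph is again
(locally) a graph, that is, when `q ↦ (t̃, x̃)(q, u q)` is nondegenerate at `p`. The functions `u`
and `v` are not assumed to be solutions; the equations are only evaluated at one point. -/
def PointTransformation.MapsEquation (φ : PointTransformation) (V W : Potential) : Prop :=
  ∀ (p : Base) (u v : Base → ℂ),
    (p, u p) ∈ φ.source →
    ContDiffAt ℝ ∞ u p →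
    Function.Bijective (fderiv ℝ (fun q => (φ.toFun (q, u q)).1) p) →
    ContDiffAt ℝ ∞ v (φ.toFun (p, u p)).1 →
    (∀ᶠ q in 𝓝 p, v (φ.toFun (q, u q)).1 = (φ.toFun (q, u q)).2) →
    (V.lhs u p = 0 ↔ W.lhs v (φ.toFun (p, u p)).1 = 0)

/-- The equivalence groupoid of the class of Schrödinger equations `i ψ_t + ψ_xx + V(t,x) ψ = 0`:
the set of all its admissible transformations `(V, Ṽ, φ)`. -/
def equivalenceGroupoid : Set (Potential × Potential × PointTransformation) :=
  {γ | (∀ z ∈ γ.2.2.source, z.1 ∈ γ.1.dom) ∧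
    (∀ z ∈ γ.2.2.source, (γ.2.2.toFun z).1 ∈ γ.2.1.dom) ∧
    γ.2.2.MapsEquation γ.1 γ.2.1}

/-- The set of `t`-values of points of `Ω`. -/
def times (Ω : Set Total) : Set ℝ := (fun z : Total => z.1.1) '' Ω

/-- The set of `(t, x)`-values of points of `Ω`. -/
def base (Ω : Set Total) : Set Base := Prod.fst '' Ω

/-- `Ω`, its slices `t = const` and its fibres `(t, x) = const` are connected (or empty). -/
def SliceConnected (Ω : Set Total) : Prop :=
  IsPreconnected Ω ∧
    (∀ t : ℝ, IsPreconnected {y : ℝ × ℂ | ((t, y.1), y.2) ∈ Ω}) ∧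
    (∀ p : Base, IsPreconnected {w : ℂ | (p, w) ∈ Ω})

/-- `β̂`: it is `β` if `s > 0` and the complex conjugate of `β` otherwise
(used with `s = T_t ≠ 0`). -/
def hat (s : ℝ) (β : ℂ) : ℂ := if 0 < s then β else (starRingEnd ℂ) β

/-- The parameters `T`, `X⁰`, `Σ`, `Υ`, `ε`, `Φ`. -/
structure Params where
  T : ℝ → ℝ
  X0 : ℝ → ℝ
  sigma : ℝ → ℝ
  upsilon : ℝ → ℝ
  eps : ℝ
  Phi : Base → ℂ

namespace Params

/-- The requirements on the parameters, over the region `Ω`: `T`, `X⁰`, `Σ`, `Υ` are smooth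
functions of `t` with `T_t ≠ 0`, `ε = ±1`, and `Φ` is a solution of the equation with
potential `V`. -/
def IsValidOn (P : Params) (V : Potential) (Ω : Set Total) : Prop :=
  base Ω ⊆ V.dom ∧
  ContDiffOn ℝ ∞ P.T (times Ω) ∧ ContDiffOn ℝ ∞ P.X0 (times Ω) ∧
  ContDiffOn ℝ ∞ P.sigma (times Ω) ∧ ContDiffOn ℝ ∞ P.upsilon (times Ω) ∧
  (∀ t ∈ times Ω, deriv P.T t ≠ 0) ∧
  (P.eps = 1 ∨ P.eps = -1) ∧
  V.IsSolutionOn P.Phi (base Ω)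

/-- `ε' = sgn T_t`. -/
def eps' (P : Params) (t : ℝ) : ℝ := Real.sign (deriv P.T t)

/-- `(t, x) ↦ (t̃, x̃) = (T, ε |T_t|^{1/2} x + X⁰)`. -/
def baseMap (P : Params) (p : Base) : Base :=
  (P.T p.1, P.eps * Real.sqrt |deriv P.T p.1| * p.2 + P.X0 p.1)

/-- The exponential factor
`exp ((i/8) (T_tt / |T_t|) x² + (i/2) (ε ε' X⁰_t / |T_t|^{1/2}) x + i Σ + Υ)`. -/
def factor (P : Params) (p : Base) : ℂ :=
  Complex.exp
    (Complex.I / 8 * ((deriv (deriv P.T) p.1 / |deriv P.T p.1| : ℝ) : ℂ) * (p.2 : ℂ) ^ 2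
      + Complex.I / 2 *
        ((P.eps * P.eps' p.1 * deriv P.X0 p.1 / Real.sqrt |deriv P.T p.1| : ℝ) : ℂ) * (p.2 : ℂ)
      + Complex.I * (P.sigma p.1 : ℂ) + (P.upsilon p.1 : ℂ))

/-- The point transformation with the given parameters. -/
def map (P : Params) (z : Total) : Total :=
  (P.baseMap z.1,
    P.factor z.1 * (hat (deriv P.T z.1.1) z.2 + hat (deriv P.T z.1.1) (P.Phi z.1)))

/-- The value of the transformed potential at the image of the point `p = (t, x)`. -/
def newPotential (P : Params) (V : Potential) (p : Base) : ℂ :=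
  hat (deriv P.T p.1) (V.toFun p) / (|deriv P.T p.1| : ℝ)
    + (((2 * deriv (deriv (deriv P.T)) p.1 * deriv P.T p.1 - 3 * deriv (deriv P.T) p.1 ^ 2)
        / (16 * P.eps' p.1 * deriv P.T p.1 ^ 3) * p.2 ^ 2 : ℝ) : ℂ)
    + ((P.eps * P.eps' p.1 / (2 * Real.sqrt |deriv P.T p.1|)
        * deriv (fun s => deriv P.X0 s / deriv P.T s) p.1 * p.2 : ℝ) : ℂ)
    - (Complex.I * (deriv (deriv P.T) p.1 : ℝ) + ((deriv P.X0 p.1 ^ 2 : ℝ) : ℂ))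
        / ((4 * deriv P.T p.1 ^ 2 : ℝ) : ℂ)
    + ((deriv P.sigma p.1 : ℝ) - Complex.I * (deriv P.upsilon p.1 : ℝ)) / (deriv P.T p.1 : ℝ)

end Params

/-- Over `Ω`, the triple `(V, W, φ)` is given by the explicit formulas with parameters `P`. -/
def HasForm (V W : Potential) (φ : PointTransformation) (P : Params) (Ω : Set Total) : Prop :=
  P.IsValidOn V Ω ∧
  Set.EqOn φ.toFun P.map Ω ∧
  ∀ p ∈ base Ω, P.baseMap p ∈ W.dom ∧ W.toFun (P.baseMap p) = P.newPotential V p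

end LinSch

end

/-!
The argument compares the two equations on the second-order jet space. For a function `u` with
prescribed first derivative `ℓ` and second derivative `Q` at a point, the inverse function theorem
provides the function `v` whose graph is the image of the graph of `u`, and the chain rule for
second derivatives expresses the transformed equation through `ℓ`, `Q` and the first two derivatives
of the transformation (`PointTransformation.MapsEquation.jet_iff`). Since the transformed equation
has to hold exactly when the original one does, varying the jet gives the determining equations:

* `u_tt` is free, hence `t̃` depends only on `t` (`time_eq_zero`);
* `u_t` is free and `u_xx = -i u_t - V u`, which leads to `κ² = 1` for `κ = T_t / (D_x X)²`. Hence
  `x̃` does not depend on `ψ`, `X_x² = |T_t|`, and `ψ̃` has a complex-linear or antilinear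
  derivative in `ψ`, according to the sign of `T_t` (`first_order`);
* `u_x` is free, and the equation is quadratic in it: `ψ̃` is affine in `ψ̂`, and the `x`-derivative
  of the coefficient `A` of `ψ̂` is determined (`second_order`).

Connectedness of `Ω`, of its slices and of its fibres serves to integrate these equations: a
function whose derivative vanishes along the connected fibres of a projection is a smooth function
of the projection (`exists_contDiffOn_eq_comp`). This yields `T`, `X⁰`, the coefficients `A`, `B` of
`ψ̃ = A ψ̂ + B`, and the function of `t` by which `A` differs from the exponential factor; this
function is nonvanishing on an interval, so it has a smooth logarithm `iΣ + Υ`. Finally `Φ̂ = B / A`.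

The remaining conditions, that `Φ` is a solution and that the new potential has the stated form, as
well as the converse, follow from one identity, `Params.RegularAt.lhs_transformed`: if `v` is the
image of `u` under the explicit transformation, the left-hand side of the new equation at `v` is
`(factor / |T_t|)` times the hat of the old one at `u + Φ`, plus a multiple of the difference
between the new potential and the explicit formula. Over an arbitrary domain the result is applied to balls.
For arbitrary parameters over a connected domain, `T` is injective by Rolle's theorem, hence so is
the map of the independent variables, and the new potential can be pushed forward along it.
-/

namespace LinSch

/-! ### Calculus on open subsets of normed spaces -/

section Calculus

variable {E F G : Type*} [NormedAddCommGroup E] [NormedSpace ℝ E]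
  [NormedAddCommGroup F] [NormedSpace ℝ F] [NormedAddCommGroup G] [NormedSpace ℝ G]

/-- The chain rule for second derivatives. -/
theorem fderiv_fderiv_comp {f : F → G} {g : E → F} {p : E}
    (hf : ContDiffAt ℝ ∞ f (g p)) (hg : ContDiffAt ℝ ∞ g p) (a b : E) :
    fderiv ℝ (fderiv ℝ (fun q => f (g q))) p a b =
      fderiv ℝ (fderiv ℝ f) (g p) (fderiv ℝ g p a) (fderiv ℝ g p b)
        + fderiv ℝ f (g p) (fderiv ℝ (fderiv ℝ g) p a b) := by
  have h1le : (1 : WithTop ℕ∞) ≤ ∞ := mod_cast le_top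
  have hf1 : ∀ᶠ y in 𝓝 (g p), ContDiffAt ℝ 1 f y := (hf.of_le h1le).eventually (by simp)
  have hg1 : ∀ᶠ q in 𝓝 p, ContDiffAt ℝ 1 g q := (hg.of_le h1le).eventually (by simp)
  have h1 : fderiv ℝ (fun q => f (g q)) =ᶠ[𝓝 p]
      fun q => (fderiv ℝ f (g q)).comp (fderiv ℝ g q) := by
    filter_upwards [hg.continuousAt.eventually hf1, hg1] with q h2 h3
    exact fderiv_comp q (h2.differentiableAt (by simp)) (h3.differentiableAt (by simp))
  have hdf : DifferentiableAt ℝ (fderiv ℝ f) (g p) :=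
    (hf.fderiv_right (m := 1) (by norm_cast)).differentiableAt (by simp)
  have hdg : DifferentiableAt ℝ (fderiv ℝ g) p :=
    (hg.fderiv_right (m := 1) (by norm_cast)).differentiableAt (by simp)
  have hg0 : DifferentiableAt ℝ g p := hg.differentiableAt (by simp)
  have h2 : HasFDerivAt (fun q => fderiv ℝ f (g q))
      ((fderiv ℝ (fderiv ℝ f) (g p)).comp (fderiv ℝ g p)) p :=
    hdf.hasFDerivAt.comp p hg0.hasFDerivAt
  rw [h1.fderiv_eq, (h2.clm_comp hdg.hasFDerivAt).fderiv]
  simp [add_comm]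

/-- Second derivatives of smooth functions are symmetric. -/
theorem fderiv_fderiv_symm {f : E → F} {z : E} (hf : ContDiffAt ℝ ∞ f z) (a b : E) :
    fderiv ℝ (fderiv ℝ f) z a b = fderiv ℝ (fderiv ℝ f) z b a :=
  (hf.isSymmSndFDerivAt (by
    rw [minSmoothness_of_isRCLikeNormedField]
    exact WithTop.coe_le_coe.2 le_top)) a b

theorem fderiv_fderiv_apply {f : E → F} {z : E} (hf : ContDiffAt ℝ ∞ f z) (a b : E) :
    fderiv ℝ (fun y => fderiv ℝ f y b) z a = fderiv ℝ (fderiv ℝ f) z a b := by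
  have hdf : DifferentiableAt ℝ (fderiv ℝ f) z :=
    (hf.fderiv_right (m := 1) (by norm_cast)).differentiableAt (by simp)
  rw [(hdf.hasFDerivAt.clm_apply (hasFDerivAt_const b z)).fderiv]
  simp

/-- Smooth functions can be transported along a map with bijective derivative. -/
theorem exists_contDiffAt_comp_eq [FiniteDimensional ℝ E] [CompleteSpace F] {f : E → F} {g : E → G}
    {p : E} (hf : ContDiffAt ℝ ∞ f p) (hg : ContDiffAt ℝ ∞ g p)
    (hb : Function.Bijective (fderiv ℝ f p)) :
    ∃ v : F → G, ContDiffAt ℝ ∞ v (f p) ∧ ∀ᶠ q in 𝓝 p, v (f q) = g q := by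
  have : CompleteSpace E := FiniteDimensional.complete ℝ E
  let e : E ≃L[ℝ] F := ContinuousLinearEquiv.ofBijective (fderiv ℝ f p)
    (LinearMap.ker_eq_bot.2 hb.1) (LinearMap.range_eq_top.2 hb.2)
  have he : HasFDerivAt f (e : E →L[ℝ] F) p := by
    rw [ContinuousLinearEquiv.coe_ofBijective]
    exact (hf.differentiableAt (by simp)).hasFDerivAt
  have hinv := hf.to_localInverse he (by simp)
  have hstrict : HasStrictFDerivAt f (e : E →L[ℝ] F) p := hf.hasStrictFDerivAt' he (by simp)
  have hleft : ∀ᶠ q in 𝓝 p, hf.localInverse he (by simp) (f q) = q :=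
    hstrict.eventually_left_inverse
  refine ⟨fun y => g (hf.localInverse he (by simp) y), ?_, ?_⟩
  · refine ContDiffAt.comp (f p) ?_ hinv
    rwa [hleft.self_of_nhds]
  · filter_upwards [hleft] with q hq
    rw [hq]

/-- A function whose derivative vanishes along the fibres of a linear projection `π`, these fibres
being connected, is a smooth function of `π z`. -/
theorem exists_contDiffOn_eq_comp (π : E →L[ℝ] F) (s : F →L[ℝ] E) (hs : ∀ a, π (s a) = a)
    {Ω : Set E} (hΩ : IsOpen Ω) (hc : ∀ a, IsPreconnected (Ω ∩ π ⁻¹' {a})) {f : E → G}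
    (hf : ContDiffOn ℝ ∞ f Ω) (h0 : ∀ z ∈ Ω, ∀ c, π c = 0 → fderiv ℝ f z c = 0) :
    ∃ g : F → G, ContDiffOn ℝ ∞ g (π '' Ω) ∧ ∀ z ∈ Ω, f z = g (π z) := by
  classical
  -- `f` is locally constant along the fibres, by the mean value theorem on a ball
  have hloc : ∀ z ∈ Ω, ∀ᶠ y in 𝓝 z, π y = π z → f y = f z := by
    intro z hz
    obtain ⟨r, hr, hball⟩ := Metric.isOpen_iff.1 hΩ z hz
    filter_upwards [Metric.ball_mem_nhds z hr] with y hy hπ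
    have hseg : ∀ τ ∈ Set.Icc (0 : ℝ) 1, z + τ • (y - z) ∈ Ω := fun τ hτ => hball <|
      (convex_ball z r).add_smul_sub_mem (Metric.mem_ball_self hr) hy hτ
    have hd : ∀ τ ∈ Set.Icc (0 : ℝ) 1, HasDerivAt (fun τ : ℝ => f (z + τ • (y - z))) 0 τ := by
      intro τ hτ
      have h1 : HasFDerivAt f (fderiv ℝ f (z + τ • (y - z))) (z + τ • (y - z)) :=
        ((hf.contDiffAt (hΩ.mem_nhds (hseg τ hτ))).differentiableAt (by simp)).hasFDerivAt
      have h2 : HasDerivAt (fun τ : ℝ => z + τ • (y - z)) (y - z) τ := by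
        simpa using ((hasDerivAt_id τ).smul_const (y - z)).const_add z
      have := h1.comp_hasDerivAt τ h2
      rwa [h0 _ (hseg τ hτ) _ (by simp [hπ])] at this
    have := constant_of_has_deriv_right_zero
      (fun τ hτ => (hd τ hτ).continuousAt.continuousWithinAt)
      (fun τ hτ => (hd τ ⟨hτ.1, hτ.2.le⟩).hasDerivWithinAt) 1 (by simp)
    simpa using this
  have hconst : ∀ z ∈ Ω, ∀ y ∈ Ω, π y = π z → f y = f z := by
    intro z hz y hy hπ
    refine (hc (π z)).induction₂ (fun a b => f b = f a) ?_ ?_ ?_ ⟨hz, rfl⟩ ⟨hy, hπ⟩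
    · rintro a ⟨ha, ha'⟩
      filter_upwards [nhdsWithin_le_nhds (hloc a ha), self_mem_nhdsWithin] with b hb hb'
      exact hb (hb'.2.trans ha'.symm)
    · intro a b c _ _ _ hab hbc
      exact hbc.trans hab
    · intro a b _ _ h
      exact h.symm
  refine ⟨fun a => if h : ∃ z ∈ Ω, π z = a then f h.choose else 0, ?_, ?_⟩
  · rintro _ ⟨z, hz, rfl⟩
    have hcont : ContinuousAt (fun a => z + s (a - π z)) (π z) := by fun_prop
    have hmem : ∀ᶠ a in 𝓝 (π z), z + s (a - π z) ∈ Ω :=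
      hcont.eventually (by simpa using hΩ.mem_nhds hz)
    have hsm : ContDiffAt ℝ ∞ (fun a => f (z + s (a - π z))) (π z) := by
      have h1 : ContDiffAt ℝ ∞ f (z + s (π z - π z)) := by
        simpa using hf.contDiffAt (hΩ.mem_nhds hz)
      exact h1.comp (π z) (f := fun a => z + s (a - π z)) (by fun_prop)
    refine (hsm.congr_of_eventuallyEq ?_).contDiffWithinAt
    filter_upwards [hmem] with a ha
    have hex : ∃ z ∈ Ω, π z = a := ⟨_, ha, by simp [hs]⟩
    rw [dif_pos hex]
    exact hconst _ ha _ hex.choose_spec.1 (by rw [hex.choose_spec.2]; simp [hs])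
  · intro z hz
    have hex : ∃ y ∈ Ω, π y = π z := ⟨z, hz, rfl⟩
    simp only [dif_pos hex]
    exact (hconst _ hz _ hex.choose_spec.1 hex.choose_spec.2).symm

end Calculus

/-- A nowhere vanishing smooth complex function on an open interval has a smooth logarithm. -/
theorem exists_contDiffOn_exp_eq {I : Set ℝ} (hI : IsOpen I) (hc : IsPreconnected I) {f : ℝ → ℂ}
    (hf : ContDiffOn ℝ ∞ f I) (h0 : ∀ t ∈ I, f t ≠ 0) :
    ∃ L : ℝ → ℂ, ContDiffOn ℝ ∞ L I ∧ ∀ t ∈ I, Complex.exp (L t) = f t := by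
  rcases I.eq_empty_or_nonempty with rfl | ⟨t₀, ht₀⟩
  · exact ⟨0, by simp, by simp⟩
  have hdf : ContDiffOn ℝ ∞ (deriv f) I := hf.deriv_of_isOpen hI (by simp)
  have hq : ContDiffOn ℝ ∞ (fun t => deriv f t / f t) I := by
    simpa only [div_eq_mul_inv] using! hdf.mul (hf.inv h0)
  have hsub : ∀ t ∈ I, Set.uIcc t₀ t ⊆ I := fun t ht =>
    hc.ordConnected.uIcc_subset ht₀ ht
  let L : ℝ → ℂ := fun t => Complex.log (f t₀) + ∫ τ in t₀..t, deriv f τ / f τ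
  have hL : ∀ t ∈ I, HasDerivAt L (deriv f t / f t) t := by
    intro t ht
    refine HasDerivAt.const_add _ ?_
    refine intervalIntegral.integral_hasDerivAt_right
      ((hq.continuousOn.mono (hsub t ht)).intervalIntegrable) ?_
      (hq.continuousOn.continuousAt (hI.mem_nhds ht))
    exact hq.continuousOn.stronglyMeasurableAtFilter hI t ht
  refine ⟨L, ?_, ?_⟩
  · rw [contDiffOn_infty_iff_deriv_of_isOpen hI]
    exact ⟨fun t ht => (hL t ht).differentiableAt.differentiableWithinAt,
      hq.congr fun t ht => (hL t ht).deriv⟩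
  · intro t ht
    have hconst : ∀ τ ∈ I, HasDerivAt (fun τ => Complex.exp (-L τ) * f τ) 0 τ := by
      intro τ hτ
      have h1 := ((hL τ hτ).neg.cexp).mul
        ((hf.contDiffAt (hI.mem_nhds hτ)).differentiableAt (by simp)).hasDerivAt
      have h2 : Complex.exp (-L τ) * -(deriv f τ / f τ) * f τ + Complex.exp (-L τ) * deriv f τ
          = 0 := by
        have := h0 τ hτ
        field_simp
        ring
      exact h2 ▸ h1
    have h2 : Complex.exp (-L t) * f t = Complex.exp (-L t₀) * f t₀ := by
      refine hI.is_const_of_deriv_eq_zero hc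
        (fun τ hτ => (hconst τ hτ).differentiableAt.differentiableWithinAt)
        (fun τ hτ => (hconst τ hτ).deriv) ht ht₀
    have h3 : L t₀ = Complex.log (f t₀) := by simp [L]
    rw [h3, Complex.exp_neg, Complex.exp_neg, Complex.exp_log (h0 _ ht₀),
      inv_mul_cancel₀ (h0 _ ht₀)] at h2
    field_simp at h2
    exact h2.symm

/-! ### Point transformations on the level of jets -/

theorem clm_total_decomp {F : Type*} [NormedAddCommGroup F] [NormedSpace ℝ F] (L : Total →L[ℝ] F)
    (t x : ℝ) (b : ℂ) :
    L ((t, x), b) = t • L ((1, 0), 0) + x • L ((0, 1), 0) + L (0, b) := by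
  rw [← map_smul, ← map_smul, ← map_add, ← map_add]
  simp

theorem PointTransformation.contDiffAt (φ : PointTransformation) {z : Total} (hz : z ∈ φ.source) :
    ContDiffAt ℝ ∞ φ.toFun z :=
  φ.smooth.contDiffAt (φ.isOpen_source.mem_nhds hz)

theorem hasFDerivAt_quadratic (ψ : ℂ) (p : Base) (ℓ : Base →L[ℝ] ℂ) (Q : Base →L[ℝ] Base →L[ℝ] ℂ)
    (hQ : ∀ y y', Q y y' = Q y' y) (q : Base) :
    HasFDerivAt (fun q => ψ + ℓ (q - p) + (1 / 2 : ℝ) • Q (q - p) (q - p)) (ℓ + Q (q - p)) q := by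
  have h1 : HasFDerivAt (fun q : Base => q - p) (ContinuousLinearMap.id ℝ Base) q :=
    (hasFDerivAt_id q).sub_const p
  have h2 := ℓ.hasFDerivAt.comp q h1
  have h3 := (Q.hasFDerivAt.comp q h1).clm_apply h1
  have h4 := ((h2.const_add ψ).add (h3.const_smul (1 / 2 : ℝ)))
  convert! h4 using 1
  ext
  · simp [hQ (1, 0)]
    ring
  · simp [hQ (0, 1)]
    ring

/-- The left-hand side of the equation, evaluated at the 2-jet of a quadratic polynomial. -/
theorem Potential.lhs_quadratic (V : Potential) (ψ : ℂ) (p : Base) (ℓ : Base →L[ℝ] ℂ)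
    (Q : Base →L[ℝ] Base →L[ℝ] ℂ) (hQ : ∀ y y', Q y y' = Q y' y) :
    V.lhs (fun q => ψ + ℓ (q - p) + (1 / 2 : ℝ) • Q (q - p) (q - p)) p =
      Complex.I * ℓ (1, 0) + Q (0, 1) (0, 1) + V.toFun p * ψ := by
  set u : Base → ℂ := fun q => ψ + ℓ (q - p) + (1 / 2 : ℝ) • Q (q - p) (q - p) with hu_def
  have hu : ∀ q, HasFDerivAt u (ℓ + Q (q - p)) q := hasFDerivAt_quadratic ψ p ℓ Q hQ
  have hus : ContDiff ℝ ∞ u := by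
    rw [hu_def]
    fun_prop
  have hup : u p = ψ := by simp [u]
  have h1 : dx (dx u) p = Q (0, 1) (0, 1) := by
    unfold dx
    rw [fderiv_fderiv_apply hus.contDiffAt]
    have h2 : fderiv ℝ u = fun q => ℓ + Q (q - p) := funext fun q => (hu q).fderiv
    have h3 : HasFDerivAt (fun q : Base => q - p) (ContinuousLinearMap.id ℝ Base) p :=
      (hasFDerivAt_id p).sub_const p
    rw [h2]
    have h4 := ((Q.hasFDerivAt.comp p h3).const_add ℓ).fderiv
    erw [h4]
    simp
  unfold Potential.lhs
  rw [h1, hup]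
  simp [dt, (hu _).fderiv]

theorem fderiv_fderiv_clm_comp {E F G : Type*} [NormedAddCommGroup E] [NormedSpace ℝ E]
    [NormedAddCommGroup F] [NormedSpace ℝ F] [NormedAddCommGroup G] [NormedSpace ℝ G]
    (L : F →L[ℝ] G) {g : E → F} {p : E} (hg : ContDiffAt ℝ ∞ g p) (a b : E) :
    fderiv ℝ (fderiv ℝ (fun q => L (g q))) p a b = L (fderiv ℝ (fderiv ℝ g) p a b) := by
  rw [fderiv_fderiv_comp L.contDiff.contDiffAt hg]
  have : fderiv ℝ (L : F → G) = fun _ => L := by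
    ext1 y
    exact L.fderiv
  simp [this]

/-- The condition that `φ` maps one Schrödinger equation to another, expressed in coordinates of
the second-order jet space. The jet has the first derivative `ℓ` and the second derivative `Q`; the
vectors `w₀`, `w` are the preimages of the coordinate vectors of the `(t̃, x̃)`-plane under the
derivative of `q ↦ (t̃, x̃)(q, u q)`, and `Y` is the second derivative of `q ↦ φ (q, u q)` along
`w`. -/
theorem PointTransformation.MapsEquation.jet_iff {φ : PointTransformation} {V W : Potential}
    (hφ : φ.MapsEquation V W) {z : Total} (hz : z ∈ φ.source) (ℓ : Base →L[ℝ] ℂ)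
    (Q : Base →L[ℝ] Base →L[ℝ] ℂ) (hQ : ∀ y y', Q y y' = Q y' y) {w₀ w : Base} {Y : Total}
    (hw₀ : (fderiv ℝ φ.toFun z (w₀, ℓ w₀)).1 = (1, 0))
    (hw : (fderiv ℝ φ.toFun z (w, ℓ w)).1 = (0, 1))
    (hY : Y = fderiv ℝ (fderiv ℝ φ.toFun) z (w, ℓ w) (w, ℓ w) + fderiv ℝ φ.toFun z (0, Q w w)) :
    (Complex.I * ℓ (1, 0) + Q (0, 1) (0, 1) + V.toFun z.1 * z.2 = 0 ↔
      Complex.I * (fderiv ℝ φ.toFun z (w₀, ℓ w₀)).2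
        + (Y.2 - Y.1.1 • (fderiv ℝ φ.toFun z (w₀, ℓ w₀)).2
          - Y.1.2 • (fderiv ℝ φ.toFun z (w, ℓ w)).2)
        + W.toFun (φ.toFun z).1 * (φ.toFun z).2 = 0) := by
  set D := fderiv ℝ φ.toFun z with hD
  set u : Base → ℂ := fun q => z.2 + ℓ (q - z.1) + (1 / 2 : ℝ) • Q (q - z.1) (q - z.1) with hu_def
  have hu : ∀ q, HasFDerivAt u (ℓ + Q (q - z.1)) q := hasFDerivAt_quadratic z.2 z.1 ℓ Q hQ
  have hus : ContDiff ℝ ∞ u := by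
    rw [hu_def]
    fun_prop
  have hup : u z.1 = z.2 := by simp [u]
  have hz' : (z.1, u z.1) = z := by rw [hup]
  -- the graph of `u` and its first two derivatives
  set U : Base → Total := fun q => (q, u q) with hU_def
  have hUz : U z.1 = z := hz'
  have hUs : ContDiffAt ℝ ∞ U z.1 := (contDiff_id.prodMk hus).contDiffAt
  have hU : ∀ q, fderiv ℝ U q = (ContinuousLinearMap.id ℝ Base).prod (ℓ + Q (q - z.1)) :=
    fun q => ((hasFDerivAt_id q).prodMk (hu q)).fderiv
  have hU1 : ∀ y, fderiv ℝ U z.1 y = (y, ℓ y) := by simp [hU]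
  have hU2 : ∀ y y', fderiv ℝ (fderiv ℝ U) z.1 y y' = (0, Q y y') := by
    intro y y'
    rw [← fderiv_fderiv_apply hUs]
    have h1 : HasFDerivAt (fun q : Base => q - z.1) (ContinuousLinearMap.id ℝ Base) z.1 :=
      (hasFDerivAt_id z.1).sub_const z.1
    have h2 := (Q.hasFDerivAt.comp z.1 h1).clm_apply (hasFDerivAt_const y' z.1)
    have h3 := (hasFDerivAt_const y' z.1).prodMk (h2.const_add (ℓ y'))
    have h4 : (fun q => fderiv ℝ U q y') = fun q => (y', ℓ y' + Q (q - z.1) y') := by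
      ext1 q
      simp [hU]
    rw [h4]
    erw [h3.fderiv]
    simp
  have hφz : ContDiffAt ℝ ∞ φ.toFun (U z.1) := by
    rw [hUz]
    exact φ.contDiffAt hz
  set η : Base → Total := fun q => φ.toFun (U q) with hη_def
  have hηs : ContDiffAt ℝ ∞ η z.1 := hφz.comp z.1 hUs
  have hηz : η z.1 = φ.toFun z := by rw [hη_def]; simp only [hUz]
  have hη1 : ∀ y, fderiv ℝ η z.1 y = D (y, ℓ y) := by
    intro y
    have := fderiv_comp z.1 (hφz.differentiableAt (by simp)) (hUs.differentiableAt (by simp))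
    rw [show η = φ.toFun ∘ U from rfl, this]
    simp [hUz, hU1, hD]
  have hη2 : fderiv ℝ (fderiv ℝ η) z.1 w w = Y := by
    rw [hη_def, fderiv_fderiv_comp hφz hUs, hU1, hU2, hUz, hY]
  have hηd : HasFDerivAt η (fderiv ℝ η z.1) z.1 := (hηs.differentiableAt (by simp)).hasFDerivAt
  have hη1s : ContDiffAt ℝ ∞ (fun q => (η q).1) z.1 := hηs.fst
  have hη2s : ContDiffAt ℝ ∞ (fun q => (η q).2) z.1 := hηs.snd
  have hF1 : ∀ y, fderiv ℝ (fun q => (η q).1) z.1 y = (D (y, ℓ y)).1 := by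
    intro y
    rw [hηd.fst.fderiv, ← hη1]
    rfl
  have hG1 : ∀ y, fderiv ℝ (fun q => (η q).2) z.1 y = (D (y, ℓ y)).2 := by
    intro y
    rw [hηd.snd.fderiv, ← hη1]
    rfl
  have hF2 : fderiv ℝ (fderiv ℝ (fun q => (η q).1)) z.1 w w = Y.1 := by
    rw [← hη2]
    exact fderiv_fderiv_clm_comp (ContinuousLinearMap.fst ℝ Base ℂ) hηs w w
  have hG2 : fderiv ℝ (fderiv ℝ (fun q => (η q).2)) z.1 w w = Y.2 := by
    rw [← hη2]
    exact fderiv_fderiv_clm_comp (ContinuousLinearMap.snd ℝ Base ℂ) hηs w w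
  have hsurj : Function.Surjective (fderiv ℝ (fun q => (η q).1) z.1) := by
    rintro ⟨α, β⟩
    refine ⟨α • w₀ + β • w, ?_⟩
    rw [map_add, map_smul, map_smul, hF1, hF1, hw₀, hw]
    simp
  have hbij : Function.Bijective (fderiv ℝ (fun q => (η q).1) z.1) :=
    ⟨(LinearMap.injective_iff_surjective
      (f := (fderiv ℝ (fun q => (η q).1) z.1).toLinearMap)).2 hsurj, hsurj⟩
  obtain ⟨v, hv, hvη⟩ := exists_contDiffAt_comp_eq hη1s hη2s hbij
  have hvη' : (fun q => v (η q).1) =ᶠ[𝓝 z.1] fun q => (η q).2 := hvη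
  -- the first two derivatives of the transformed function
  have hv1 : ∀ y, fderiv ℝ v (η z.1).1 (D (y, ℓ y)).1 = (D (y, ℓ y)).2 := by
    intro y
    have := fderiv_comp z.1 (hv.differentiableAt (by simp)) (hη1s.differentiableAt (by simp))
    rw [← hG1, ← hvη'.fderiv_eq, ← hF1,
      show (fun q => v (η q).1) = v ∘ fun q => (η q).1 from rfl, this]
    rfl
  have hv2 : fderiv ℝ (fderiv ℝ v) (η z.1).1 (0, 1) (0, 1) + fderiv ℝ v (η z.1).1 Y.1 = Y.2 := by
    rw [← hG2, ← hvη'.fderiv.fderiv_eq,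
      fderiv_fderiv_comp (f := v) (g := fun q => (η q).1) hv hη1s, hF1, hw, hF2]
  have hvt : fderiv ℝ v (η z.1).1 (1, 0) = (D (w₀, ℓ w₀)).2 := by rw [← hv1, hw₀]
  have hvx : fderiv ℝ v (η z.1).1 (0, 1) = (D (w, ℓ w)).2 := by rw [← hv1, hw]
  have hvY : fderiv ℝ v (η z.1).1 Y.1 = Y.1.1 • (D (w₀, ℓ w₀)).2 + Y.1.2 • (D (w, ℓ w)).2 := by
    rw [← hvt, ← hvx, ← map_smul, ← map_smul, ← map_add]
    simp
  have hmain := hφ z.1 u v (by rwa [hz']) hus.contDiffAt hbij hv hvη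
  have hL := V.lhs_quadratic z.2 z.1 ℓ Q hQ
  have hR : W.lhs v (η z.1).1 = Complex.I * (D (w₀, ℓ w₀)).2
        + (Y.2 - Y.1.1 • (D (w₀, ℓ w₀)).2 - Y.1.2 • (D (w, ℓ w)).2)
        + W.toFun (φ.toFun z).1 * (φ.toFun z).2 := by
    have h1 : dx (dx v) (η z.1).1 = fderiv ℝ (fderiv ℝ v) (η z.1).1 (0, 1) (0, 1) := by
      unfold dx
      rw [fderiv_fderiv_apply hv]
    have h2 : v (η z.1).1 = (φ.toFun z).2 := by rw [← hηz]; exact hvη'.self_of_nhds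
    unfold Potential.lhs
    rw [h1, h2, ← hv2, hvY, hηz]
    unfold dt
    rw [← hηz, hvt]
    ring
  rw [← hL, ← hR]
  exact hmain

/-! ### Determining equations -/

/-- The quadratic form `a τ² + c ξ²` in `(τ, ξ)`, as a bilinear map. -/
noncomputable def diagForm (a c : ℂ) : Base →L[ℝ] Base →L[ℝ] ℂ :=
  (ContinuousLinearMap.fst ℝ ℝ ℝ).smulRight ((ContinuousLinearMap.fst ℝ ℝ ℝ).smulRight a)
    + (ContinuousLinearMap.snd ℝ ℝ ℝ).smulRight ((ContinuousLinearMap.snd ℝ ℝ ℝ).smulRight c)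

theorem diagForm_apply (a c : ℂ) (y y' : Base) :
    diagForm a c y y' = (y.1 * y'.1 : ℝ) * a + (y.2 * y'.2 : ℝ) * c := by
  simp [diagForm, mul_assoc]

/-- The first derivative `(s, b)` of a function, as a linear map. -/
noncomputable def jetMap (s b : ℂ) : Base →L[ℝ] ℂ :=
  (ContinuousLinearMap.fst ℝ ℝ ℝ).smulRight s + (ContinuousLinearMap.snd ℝ ℝ ℝ).smulRight b

theorem jetMap_apply (s b : ℂ) (y : Base) : jetMap s b y = y.1 * s + y.2 * b := by
  simp [jetMap]

/-- A vertical vector whose image is tangent to the image of the graph of a function vanishes. -/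
theorem eq_zero_of_tangent {D : Total →L[ℝ] Total} (hD : Function.Bijective D)
    {ℓ : Base →L[ℝ] ℂ} {w₀ w : Base} (hw₀ : (D (w₀, ℓ w₀)).1 = (1, 0))
    (hw : (D (w, ℓ w)).1 = (0, 1)) {s : ℂ}
    (hs : (D (0, s)).2 - (D (0, s)).1.1 • (D (w₀, ℓ w₀)).2 - (D (0, s)).1.2 • (D (w, ℓ w)).2 = 0) :
    s = 0 := by
  set α := (D (0, s)).1.1 with hα
  set β := (D (0, s)).1.2 with hβ
  have h1 : D (α • (w₀, ℓ w₀) + β • (w, ℓ w)) = D (0, s) := by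
    rw [map_add, map_smul, map_smul]
    refine Prod.ext ?_ ?_
    · simp only [Prod.fst_add, Prod.smul_fst, hw₀, hw]
      simp [hα, hβ]
    · simp only [Prod.snd_add, Prod.smul_snd]
      linear_combination -hs
  have h2 := hD.1 h1
  have h3 : α • w₀ + β • w = 0 := congrArg Prod.fst h2
  have h4 : α • ℓ w₀ + β • ℓ w = s := congrArg Prod.snd h2
  rw [← h4, ← map_smul, ← map_smul, ← map_add, h3, map_zero]

namespace PointTransformation.MapsEquation

variable {φ : PointTransformation} {V W : Potential} {z : Total}

/-- The new time depends only on the old time: otherwise the transformed equation would involve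
`u_tt`, on which the original equation imposes no condition. -/
theorem time_eq_zero (hφ : φ.MapsEquation V W) (hz : z ∈ φ.source) (x : ℝ) (b : ℂ) :
    (fderiv ℝ φ.toFun z ((0, x), b)).1.1 = 0 := by
  set D := fderiv ℝ φ.toFun z with hD
  have hbij : Function.Bijective D := φ.nondegenerate z hz
  suffices h : ∀ b : ℂ, (D ((0, 1), b)).1.1 = 0 by
    have h1 := clm_total_decomp D 0 x b
    have h2 := clm_total_decomp D 0 1 b
    have h0 := h 0
    have hb := h b
    rw [h2] at hb
    rw [h1]
    simp [h0] at hb ⊢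
    exact hb
  intro b
  by_contra ha
  set a := (D ((0, 1), b)).1.1 with ha_def
  set α₂ := (D ((0, 1), b)).1.2 with hα₂
  -- the derivative of `(t̃, x̃)` along the graph is invertible for some value of `u_t`
  obtain ⟨s, hs⟩ : ∃ s : ℂ, (D ((1, 0), s)).1.1 * α₂ - a * (D ((1, 0), s)).1.2 ≠ 0 := by
    by_contra! hcon
    have h0 := hcon 0
    have hall : ∀ c : Total, (D c).1.1 * α₂ - a * (D c).1.2 = 0 := by
      rintro ⟨⟨t, x⟩, r⟩
      have hr : ∀ r : ℂ, (D (0, r)).1.1 * α₂ - a * (D (0, r)).1.2 = 0 := by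
        intro r
        have h1 := hcon r
        have h2 := clm_total_decomp D 1 0 r
        rw [h2] at h1
        simp at h1
        linear_combination h1 - h0
      have h1 : (D ((0, 1), 0)).1.1 * α₂ - a * (D ((0, 1), 0)).1.2 = 0 := by
        have h2 := clm_total_decomp D 0 1 b
        have h3 := congrArg (fun z : Total => z.1.1) h2
        have h4 := congrArg (fun z : Total => z.1.2) h2
        simp at h3 h4
        rw [← ha_def] at h3
        rw [← hα₂] at h4
        linear_combination (-1 : ℝ) * hr b - α₂ * h3 + a * h4
      have h2 := clm_total_decomp D t x r
      have h3 := congrArg (fun z : Total => z.1.1) h2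
      have h4 := congrArg (fun z : Total => z.1.2) h2
      simp at h3 h4
      rw [h3, h4]
      linear_combination t * h0 + x * h1 + hr r
    obtain ⟨c, hc⟩ := hbij.2 ((0, 1), 0)
    have h1 := hall c
    rw [hc] at h1
    simp at h1
    exact ha h1
  set β₁ := (D ((1, 0), s)).1.1 with hβ₁
  set β₂ := (D ((1, 0), s)).1.2 with hβ₂
  have hE : ∀ y : Base, (D (y, jetMap s b y)).1 = (y.1 * β₁ + y.2 * a, y.1 * β₂ + y.2 * α₂) := by
    rintro ⟨t, x⟩
    have h1 : (((t, x), jetMap s b (t, x)) : Total) = t • ((1, 0), s) + x • ((0, 1), b) := by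
      simp [jetMap_apply]
    rw [h1, map_add, map_smul, map_smul]
    exact Prod.ext (by simp [hβ₁, ha_def]) (by simp [hβ₂, hα₂])
  set δ := β₁ * α₂ - a * β₂ with hδ
  have hw₀ : (D ((α₂ / δ, -β₂ / δ), jetMap s b (α₂ / δ, -β₂ / δ))).1 = (1, 0) := by
    rw [hE]
    refine Prod.ext ?_ ?_
    · simp only
      field_simp
      linear_combination -hδ
    · simp only
      field_simp
      ring
  have hw : (D ((-a / δ, β₁ / δ), jetMap s b (-a / δ, β₁ / δ))).1 = (0, 1) := by
    rw [hE]
    refine Prod.ext ?_ ?_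
    · simp only
      field_simp
      ring
    · simp only
      field_simp
      linear_combination -hδ
  set w : Base := (-a / δ, β₁ / δ) with hw_def
  have hw1 : w.1 ≠ 0 := div_ne_zero (neg_ne_zero.2 ha) hs
  -- two jets that differ only in `u_tt`
  set c : ℂ := -(Complex.I * s + V.toFun z.1 * z.2) with hc
  have key : ∀ r : ℂ, _ := fun r =>
    (hφ.jet_iff hz (jetMap s b) (diagForm r c) (fun y y' => by
      simp only [diagForm_apply]; push_cast; ring) hw₀ hw rfl).1 (by
      simp [diagForm_apply, jetMap_apply, hc])
  have h0 := key 0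
  have h1 := key 1
  have hsub : ((0, diagForm 1 c w w) : Total) =
      (0, diagForm 0 c w w) + (0, ((w.1 ^ 2 : ℝ) : ℂ)) := by
    refine Prod.ext (by simp) ?_
    simp [diagForm_apply]
    ring
  rw [hsub, map_add] at h1
  have h2 : ((w.1 ^ 2 : ℝ) : ℂ) = 0 := by
    refine eq_zero_of_tangent hbij hw₀ hw ?_
    simp only [Prod.fst_add, Prod.snd_add, add_smul] at h0 h1
    linear_combination h1 - h0
  exact hw1 (by simpa using h2)

theorem time_snd_eq_zero (hφ : φ.MapsEquation V W) (hz : z ∈ φ.source) (c : Total) (x : ℝ)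
    (b : ℂ) : (fderiv ℝ (fderiv ℝ φ.toFun) z c ((0, x), b)).1.1 = 0 := by
  have hs := φ.contDiffAt hz
  have hdf : DifferentiableAt ℝ (fun y => fderiv ℝ φ.toFun y ((0, x), b)) z :=
    ((hs.fderiv_right (m := 1) (by norm_cast)).differentiableAt (by simp)).clm_apply
      (differentiableAt_const _)
  rw [← fderiv_fderiv_apply hs]
  have h1 := hdf.hasFDerivAt.fst.fst
  have h2 : (fun y => (fderiv ℝ φ.toFun y ((0, x), b)).1.1) =ᶠ[𝓝 z] fun _ => 0 := by
    filter_upwards [φ.isOpen_source.mem_nhds hz] with y hy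
    exact hφ.time_eq_zero hy x b
  have h3 := h2.fderiv_eq (𝕜 := ℝ)
  rw [h1.fderiv] at h3
  simpa using DFunLike.congr_fun h3 c

theorem time_deriv_ne_zero (hφ : φ.MapsEquation V W) (hz : z ∈ φ.source) :
    (fderiv ℝ φ.toFun z ((1, 0), 0)).1.1 ≠ 0 := by
  intro h
  obtain ⟨⟨⟨t, x⟩, r⟩, hc⟩ := (φ.nondegenerate z hz).2 ((1, 0), 0)
  have h1 := congrArg (fun z : Total => z.1.1) hc
  have h2 := clm_total_decomp (fderiv ℝ φ.toFun z) t x r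
  have h3 : (fderiv ℝ φ.toFun z (0, r)).1.1 = 0 := hφ.time_eq_zero hz 0 r
  simp [h2, h, h3, hφ.time_eq_zero hz] at h1

/-- The transformed equation at a jet `(s, b)` of first order, on the solution manifold of the
original equation, once the new time is known to depend only on the old time. Here `μ` is the
derivative `v_x̃` of the transformed function and `K` is the second derivative of the transformation
along `(0, 1, b)`. -/
theorem reduced_equation (hφ : φ.MapsEquation V W) (hz : z ∈ φ.source) {D : Total →L[ℝ] Total}
    (hD : D = fderiv ℝ φ.toFun z) {b : ℂ} (hX : (D ((0, 1), b)).1.2 ≠ 0) {μ : ℂ}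
    (hμ : μ = (D ((0, 1), b)).2 / (D ((0, 1), b)).1.2) {K : Total}
    (hK : K = fderiv ℝ (fderiv ℝ φ.toFun) z ((0, 1), b) ((0, 1), b)) (s : ℂ) :
    Complex.I / (D ((1, 0), 0)).1.1 * ((D ((1, 0), s)).2 - (D ((1, 0), s)).1.2 * μ)
      + ((D (0, -(Complex.I * s + V.toFun z.1 * z.2))).2 + K.2
        - ((D (0, -(Complex.I * s + V.toFun z.1 * z.2))).1.2 + K.1.2 : ℝ) * μ)
          / (((D ((0, 1), b)).1.2 ^ 2 : ℝ) : ℂ)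
      + W.toFun (φ.toFun z).1 * (φ.toFun z).2 = 0 := by
  set T := (D ((1, 0), 0)).1.1 with hT_def
  set X := (D ((0, 1), b)).1.2 with hX_def
  set β := (D ((1, 0), s)).1.2 with hβ
  set c : ℂ := -(Complex.I * s + V.toFun z.1 * z.2) with hc
  have hT : T ≠ 0 := by
    rw [hT_def, hD]
    exact hφ.time_deriv_ne_zero hz
  have h0 : ∀ (x : ℝ) (b : ℂ), (D ((0, x), b)).1.1 = 0 := by
    rw [hD]
    exact hφ.time_eq_zero hz
  have hTs : (D ((1, 0), s)).1.1 = T := by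
    have h1 := clm_total_decomp D 1 0 s
    have h2 : (D (0, s)).1.1 = 0 := h0 0 s
    have h3 := congrArg (fun z : Total => z.1.1) h1
    simpa [h2] using h3
  have hK0 : K.1.1 = 0 := by
    rw [hK]
    exact hφ.time_snd_eq_zero hz _ 1 b
  have hE : ∀ t x : ℝ, D ((t, x), jetMap s b (t, x)) = t • D ((1, 0), s) + x • D ((0, 1), b) := by
    intro t x
    rw [← map_smul, ← map_smul, ← map_add]
    simp [jetMap_apply]
  have hw₀ : (D ((1 / T, -β / (T * X)), jetMap s b (1 / T, -β / (T * X)))).1 = (1, 0) := by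
    rw [hE]
    refine Prod.ext ?_ ?_
    · simp [hTs, h0, hT]
    · simp [← hβ, ← hX_def]
      field_simp
      ring
  have hw : (D ((0, 1 / X), jetMap s b (0, 1 / X))).1 = (0, 1) := by
    rw [hE]
    refine Prod.ext ?_ ?_
    · simp [h0]
    · simp [← hX_def, hX]
  have hw' : ((((0, 1 / X) : Base), jetMap s b (0, 1 / X)) : Total) = (1 / X) • ((0, 1), b) := by
    simp [jetMap_apply]
  have hQ : ((0, diagForm 0 c (0, 1 / X) (0, 1 / X)) : Total) = (1 / X ^ 2) • (0, c) := by
    refine Prod.ext (by simp) ?_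
    simp [diagForm_apply]
    left
    ring
  have key := (hφ.jet_iff hz (jetMap s b) (diagForm 0 c) (fun y y' => by
      simp only [diagForm_apply]; push_cast; ring) (hD ▸ hw₀) (hD ▸ hw) rfl).1 (by
      simp [diagForm_apply, jetMap_apply, hc])
  rw [← hD, hQ, hw', map_smul, map_smul, map_smul, smul_apply, ← hK, hE,
    map_smul] at key
  have hc0 : (D (0, c)).1.1 = 0 := h0 0 c
  simp [hc0, hK0] at key
  have hT' : (T : ℂ) ≠ 0 := by exact_mod_cast hT
  have hX' : (X : ℂ) ≠ 0 := by exact_mod_cast hX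
  rw [hμ, ← key]
  push_cast
  field_simp
  ring

/-- The transformed equation and the original one impose the same condition on `u_t`. With
`M s = Ψ_ψ s - v_x̃ X_ψ s`, this reads `i M s / T_t = M (i s) / (D_x X)²` for all `s`, where `M` is
real-linear and injective. Therefore `(D_x X)² = |T_t|` wherever `D_x X ≠ 0`. This
determines the dependence of the new space variable on `x` and `ψ`, and forces the new unknown
function to depend on `ψ` complex-linearly or antilinearly, in the first order. -/
theorem first_order (hφ : φ.MapsEquation V W) (hz : z ∈ φ.source) :
    (∀ r : ℂ, (fderiv ℝ φ.toFun z (0, r)).1 = 0) ∧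
    (fderiv ℝ φ.toFun z ((0, 1), 0)).1.2 ^ 2 = |(fderiv ℝ φ.toFun z ((1, 0), 0)).1.1| ∧
    (fderiv ℝ φ.toFun z (0, 1)).2 ≠ 0 ∧
    (∀ r : ℂ, (fderiv ℝ φ.toFun z (0, r)).2 =
      (fderiv ℝ φ.toFun z (0, 1)).2 * hat (fderiv ℝ φ.toFun z ((1, 0), 0)).1.1 r) := by
  set D := fderiv ℝ φ.toFun z with hD
  have hbij : Function.Bijective D := φ.nondegenerate z hz
  set T := (D ((1, 0), 0)).1.1 with hT_def
  have hT : T ≠ 0 := hφ.time_deriv_ne_zero hz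
  have hT' : (T : ℂ) ≠ 0 := by exact_mod_cast hT
  have h0 : ∀ (x : ℝ) (b : ℂ), (D ((0, x), b)).1.1 = 0 := hφ.time_eq_zero hz
  have h0' : ∀ r, (D (0, r)).1.1 = 0 := h0 0
  have hadd : ∀ r s : ℂ, D (0, r + s) = D (0, r) + D (0, s) := by
    intro r s
    rw [← map_add]
    simp
  have hsmul : ∀ (a : ℝ) (s : ℂ), D (0, a * s) = a • D (0, s) := by
    intro a s
    rw [← map_smul]
    simp
  have hneg : ∀ s : ℂ, D (0, -s) = -D (0, s) := by
    intro s
    rw [← map_neg]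
    simp
  have hXb : ∀ b : ℂ, (D ((0, 1), b)).1.2 = (D ((0, 1), 0)).1.2 + (D (0, b)).1.2 := by
    intro b
    simp [clm_total_decomp D 0 1 b]
  -- the linear part in `s` of the reduced equation
  have main : ∀ b : ℂ, (D ((0, 1), b)).1.2 ≠ 0 → ∃ M : ℂ → ℂ, (∀ s, M s =
      (D (0, s)).2 - (D (0, s)).1.2 * ((D ((0, 1), b)).2 / (D ((0, 1), b)).1.2)) ∧
      (∀ s, Complex.I * M s / T = M (Complex.I * s) / (((D ((0, 1), b)).1.2 ^ 2 : ℝ) : ℂ)) ∧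
      (∀ s, M s = 0 → s = 0) := by
    intro b hX
    set X := (D ((0, 1), b)).1.2 with hX_def
    set μ := (D ((0, 1), b)).2 / X with hμ
    refine ⟨fun s => (D (0, s)).2 - (D (0, s)).1.2 * μ, fun s => rfl, fun s => ?_, fun s hs => ?_⟩
    · have e0 := hφ.reduced_equation hz hD hX hμ rfl 0
      have es := hφ.reduced_equation hz hD hX hμ rfl s
      have h1 : D ((1, 0), s) = D ((1, 0), 0) + D (0, s) := by
        rw [← map_add]
        simp
      have h2 : D (0, -(Complex.I * s + V.toFun z.1 * z.2))
          = -D (0, Complex.I * s) + D (0, -(Complex.I * 0 + V.toFun z.1 * z.2)) := by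
        rw [← map_neg, ← map_add]
        simp
        ring_nf
      rw [h1, h2] at es
      simp only [Prod.fst_add, Prod.snd_add, Prod.fst_neg, Prod.snd_neg] at es
      rw [← hX_def] at e0 es
      push_cast at e0 es ⊢
      linear_combination es - e0
    · have hE : ∀ t x : ℝ, D ((t, x), jetMap 0 b (t, x))
          = t • D ((1, 0), 0) + x • D ((0, 1), b) := by
        intro t x
        rw [← map_smul, ← map_smul, ← map_add]
        simp [jetMap_apply]
      set β := (D ((1, 0), 0)).1.2 with hβ
      have hw₀ : (D ((1 / T, -β / (T * X)), jetMap 0 b (1 / T, -β / (T * X)))).1 = (1, 0) := by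
        rw [hE]
        refine Prod.ext ?_ ?_
        · simp [← hT_def, h0, hT]
        · simp [← hβ, ← hX_def]
          field_simp
          ring
      have hw : (D ((0, 1 / X), jetMap 0 b (0, 1 / X))).1 = (0, 1) := by
        rw [hE]
        refine Prod.ext ?_ ?_
        · simp [h0]
        · simp [← hX_def, hX]
      refine eq_zero_of_tangent hbij hw₀ hw ?_
      rw [hE 0]
      simp only [h0']
      simp
      rw [← hs, hμ]
      ring
  -- the conditions for `s = 1` and `s = i` give `κ² = 1` for `κ = T_t / (D_x X)²`
  have hsq : ∀ b : ℂ, (D ((0, 1), b)).1.2 ≠ 0 → (D ((0, 1), b)).1.2 ^ 2 = |T| := by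
    intro b hX
    obtain ⟨M, hM, hI, hinj⟩ := main b hX
    set X := (D ((0, 1), b)).1.2 with hX_def
    have hX' : (X : ℂ) ≠ 0 := by exact_mod_cast hX
    have h1 := hI 1
    have h2 := hI Complex.I
    have h3 : M (Complex.I * Complex.I) = -M 1 := by
      simp only [hM, Complex.I_mul_I, hneg]
      simp
      ring
    have hM1 : M 1 ≠ 0 := fun h => one_ne_zero (hinj 1 h)
    rw [h3] at h2
    rw [mul_one] at h1
    push_cast at h1 h2
    field_simp at h1 h2
    have h4 : ((X : ℂ) ^ 2) ^ 2 = (T : ℂ) ^ 2 := by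
      apply mul_right_cancel₀ hM1
      linear_combination (-(X : ℂ) ^ 2 * Complex.I) * h1 - T * h2
        + (X : ℂ) ^ 4 * M 1 * Complex.I_sq
    have h5 : (X ^ 2) ^ 2 = T ^ 2 := by exact_mod_cast h4
    rw [sq_eq_sq_iff_abs_eq_abs, abs_of_nonneg (sq_nonneg X)] at h5
    exact h5
  obtain ⟨b₀, hb₀⟩ : ∃ b : ℂ, (D ((0, 1), b)).1.2 ≠ 0 := by
    by_contra! hcon
    have hx := hcon 0
    have hr : ∀ r, (D (0, r)).1.2 = 0 := by
      intro r
      have := hXb r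
      rw [hcon, hx] at this
      linarith
    obtain ⟨⟨⟨t, x⟩, r⟩, hc⟩ := hbij.2 ((0, 1), 0)
    have h1 := congrArg (fun z : Total => z.1.1) hc
    have h2 := congrArg (fun z : Total => z.1.2) hc
    have h3 := clm_total_decomp D t x r
    simp [h3, h0, h0', ← hT_def, hT] at h1
    rw [h1] at h3
    simp [h1, h3, hx, hr] at h2
  have hv2 : ∀ r, (D (0, r)).1.2 = 0 := by
    intro r
    by_contra hk
    -- along a suitable line in `b`, the quantity `D_x X` takes two values of different modulus
    have h1 := hsq b₀ hb₀
    set Y := (D ((0, 1), b₀)).1.2 with hY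
    have h2 : (D ((0, 1), b₀ + ((Y / (D (0, r)).1.2 : ℝ) : ℂ) * r)).1.2 = 2 * Y := by
      rw [hXb, hadd, hsmul]
      have h3 := hXb b₀
      simp
      field_simp
      linarith
    have h3 := hsq (b₀ + ((Y / (D (0, r)).1.2 : ℝ) : ℂ) * r) (by
      rw [h2]
      exact mul_ne_zero two_ne_zero hb₀)
    rw [h2, ← h1] at h3
    have : Y ^ 2 = 0 := by linarith
    exact hb₀ (by simpa using this)
  have hv : ∀ r : ℂ, (D (0, r)).1 = 0 := fun r => Prod.ext (h0' r) (hv2 r)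
  have hX0 : (D ((0, 1), 0)).1.2 ≠ 0 := by
    have := hXb b₀
    rw [hv2] at this
    rw [this] at hb₀
    simpa using hb₀
  have hsq0 := hsq 0 hX0
  obtain ⟨M, hM, hI, hinj⟩ := main 0 hX0
  have hM' : ∀ s, M s = (D (0, s)).2 := by
    intro s
    rw [hM, hv2]
    simp
  refine ⟨hv, hsq0, fun h => one_ne_zero (hinj 1 (by rw [hM', h])), fun r => ?_⟩
  have h1 := hI 1
  rw [hsq0, hM', hM', mul_one] at h1
  have h2 : (D (0, r)).2 = r.re * (D (0, 1)).2 + r.im * (D (0, Complex.I)).2 := by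
    have h3 : r = (r.re : ℂ) * 1 + (r.im : ℂ) * Complex.I := by
      rw [mul_one]
      exact (Complex.re_add_im r).symm
    conv_lhs => rw [h3, hadd, hsmul, hsmul]
    simp
  rw [h2]
  unfold hat
  split_ifs with hpos
  · rw [abs_of_pos hpos] at h1
    have h4 : (D (0, Complex.I)).2 = Complex.I * (D (0, 1)).2 := by
      field_simp at h1
      exact h1.symm
    rw [h4]
    linear_combination (D (0, 1)).2 * Complex.re_add_im r
  · have hneg' : T < 0 := lt_of_le_of_ne (not_lt.1 hpos) hT
    rw [abs_of_neg hneg'] at h1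
    have h4 : (D (0, Complex.I)).2 = -(Complex.I * (D (0, 1)).2) := by
      push_cast at h1
      field_simp at h1
      rw [h1]
      simp
    rw [h4]
    have h5 : (starRingEnd ℂ) r = r.re - r.im * Complex.I := by
      apply Complex.ext <;> simp
    rw [h5]
    ring

/-- The coefficients of the second and first powers of `u_x` in the transformed equation. -/
theorem second_order (hφ : φ.MapsEquation V W) (hz : z ∈ φ.source) (b : ℂ) :
    (fderiv ℝ (fderiv ℝ φ.toFun) z (0, b) (0, b)).2 = 0 ∧
    (fderiv ℝ (fderiv ℝ φ.toFun) z ((0, 1), 0) (0, b)).2 =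
      Complex.I / 2 * ((fderiv ℝ φ.toFun z ((1, 0), 0)).1.2 * (fderiv ℝ φ.toFun z ((0, 1), 0)).1.2
        / (fderiv ℝ φ.toFun z ((1, 0), 0)).1.1 : ℝ) * (fderiv ℝ φ.toFun z (0, b)).2 := by
  obtain ⟨hv, hsq, -, -⟩ := hφ.first_order hz
  have hT := hφ.time_deriv_ne_zero hz
  have hs := φ.contDiffAt hz
  have hsymm := fun a b => fderiv_fderiv_symm hs a b
  -- the vector `D_x² X` vanishes, because `D_x X` depends only on `t` and `|D_x X|² = |T_t|`
  have hK1 : ∀ b : ℂ, (fderiv ℝ (fderiv ℝ φ.toFun) z ((0, 1), b) ((0, 1), b)).1.2 = 0 := by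
    intro b
    have hd : ∀ c : Total, HasFDerivAt (fun y => fderiv ℝ φ.toFun y c)
        ((fderiv ℝ (fderiv ℝ φ.toFun) z).flip c) z := by
      intro c
      have h1 : DifferentiableAt ℝ (fderiv ℝ φ.toFun) z :=
        (hs.fderiv_right (m := 1) (by norm_cast)).differentiableAt (by simp)
      simpa using h1.hasFDerivAt.clm_apply (hasFDerivAt_const c z)
    have h1 := ((hd ((0, 1), b)).fst.snd).pow 4
    have h2 := ((hd ((1, 0), 0)).fst.fst).pow 2
    have h3 : (fun y => (fderiv ℝ φ.toFun y ((0, 1), b)).1.2 ^ 4) =ᶠ[𝓝 z]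
        fun y => (fderiv ℝ φ.toFun y ((1, 0), 0)).1.1 ^ 2 := by
      filter_upwards [φ.isOpen_source.mem_nhds hz] with y hy
      obtain ⟨hv, hsq, -, -⟩ := hφ.first_order hy
      have h4 : (fderiv ℝ φ.toFun y ((0, 1), b)).1.2 = (fderiv ℝ φ.toFun y ((0, 1), 0)).1.2 := by
        rw [clm_total_decomp _ 0 1 b]
        simp [hv]
      rw [h4, ← sq_abs (fderiv ℝ φ.toFun y ((1, 0), 0)).1.1, ← hsq]
      ring
    have h5 := DFunLike.congr_fun
      ((h1.congr_of_eventuallyEq h3.symm).unique h2) ((0, 1), b)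
    have h6 : (fderiv ℝ (fderiv ℝ φ.toFun) z ((0, 1), b) ((1, 0), 0)).1.1 = 0 := by
      rw [hsymm]
      exact hφ.time_snd_eq_zero hz _ 1 b
    have h7 : (fderiv ℝ φ.toFun z ((0, 1), b)).1.2 ≠ 0 := by
      have h4 : (fderiv ℝ φ.toFun z ((0, 1), b)).1.2 = (fderiv ℝ φ.toFun z ((0, 1), 0)).1.2 := by
        rw [clm_total_decomp _ 0 1 b]
        simp [hv]
      rw [h4]
      intro h
      rw [h] at hsq
      exact hT (by simpa using hsq.symm)
    simpa [h6, h7] using h5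
  set D := fderiv ℝ φ.toFun z with hD
  set K := fderiv ℝ (fderiv ℝ φ.toFun) z with hK
  have hXb : ∀ b : ℂ, (D ((0, 1), b)).1.2 = (D ((0, 1), 0)).1.2 := by
    intro b
    simp [clm_total_decomp D 0 1 b, hv]
  have hΨb : ∀ b : ℂ, (D ((0, 1), b)).2 = (D ((0, 1), 0)).2 + (D (0, b)).2 := by
    intro b
    simp [clm_total_decomp D 0 1 b]
  have hX : (D ((0, 1), 0)).1.2 ≠ 0 := by
    intro h
    rw [h] at hsq
    exact hT (by simpa using hsq.symm)
  have hKb : ∀ b : ℂ, (K ((0, 1), b) ((0, 1), b)).2 =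
      (K ((0, 1), 0) ((0, 1), 0)).2 + 2 * (K ((0, 1), 0) (0, b)).2 + (K (0, b) (0, b)).2 := by
    intro b
    have h1 : (((0, 1), b) : Total) = ((0, 1), 0) + (0, b) := by simp
    rw [h1, map_add K, add_apply, map_add, map_add, hsymm (0, b) ((0, 1), 0)]
    simp only [Prod.snd_add]
    ring
  -- the reduced equation is a quadratic polynomial in `b`; compare its values at `0`, `b`, `-b`
  have e : ∀ b : ℂ, _ := fun b => hφ.reduced_equation hz hD (b := b) (by rwa [hXb]) rfl rfl 0
  rw [← hK] at e
  have e0 := e 0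
  have e1 := e b
  have e2 := e (-b)
  rw [hK1] at e0
  rw [hK1, hXb, hΨb, hKb] at e1 e2
  have hn : (((0 : Base), -b) : Total) = -(0, b) := by simp
  rw [hn] at e2
  simp only [hv, map_neg, neg_apply, Prod.snd_zero, Prod.snd_neg, neg_neg] at e0 e1 e2
  have hT' : ((D ((1, 0), 0)).1.1 : ℂ) ≠ 0 := by exact_mod_cast hT
  have hX' : ((D ((0, 1), 0)).1.2 : ℂ) ≠ 0 := by exact_mod_cast hX
  push_cast at e0 e1 e2 ⊢
  field_simp at e0 e1 e2 ⊢
  constructor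
  · refine mul_left_cancel₀ (mul_ne_zero (two_ne_zero (α := ℂ)) (mul_ne_zero hT' hX')) ?_
    linear_combination e1 + e2 - 2 * e0
  · apply mul_left_cancel₀ hX'
    linear_combination (e1 - e2) / 2

end PointTransformation.MapsEquation

/-! ### The transformation rule for the left-hand side of the equation -/

theorem fderiv_apply_eq (u : Base → ℂ) (p : Base) (a b : ℝ) :
    fderiv ℝ u p (a, b) = a * dt u p + b * dx u p := by
  have h : ((a, b) : Base) = a • (1, 0) + b • (0, 1) := by simp
  rw [h, map_add, map_smul, map_smul]
  simp [dt, dx]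

/-- The derivative of a function of `(t, x)` along a curve. -/
theorem hasDerivAt_comp_curve {u : Base → ℂ} {c : ℝ → Base} {c' : Base} {s : ℝ}
    (hu : DifferentiableAt ℝ u (c s)) (hc : HasDerivAt c c' s) :
    HasDerivAt (fun s => u (c s)) (c'.1 * dt u (c s) + c'.2 * dx u (c s)) s := by
  rw [← fderiv_apply_eq]
  exact hu.hasFDerivAt.comp_hasDerivAt s hc

theorem hasDerivAt_slice_x {u : Base → ℂ} {p : Base} (hu : DifferentiableAt ℝ u p) :
    HasDerivAt (fun s => u (p.1, s)) (dx u p) p.2 := by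
  have := hasDerivAt_comp_curve (c := fun s => (p.1, s)) (s := p.2) hu
    ((hasDerivAt_const p.2 p.1).prodMk (hasDerivAt_id p.2))
  simpa using this

theorem hasDerivAt_slice_t {u : Base → ℂ} {p : Base} (hu : DifferentiableAt ℝ u p) :
    HasDerivAt (fun s => u (s, p.2)) (dt u p) p.1 := by
  have := hasDerivAt_comp_curve (c := fun s => (s, p.2)) (s := p.1) hu
    ((hasDerivAt_id p.1).prodMk (hasDerivAt_const p.1 p.2))
  simpa using this

theorem contDiffAt_dx {u : Base → ℂ} {p : Base} (hu : ContDiffAt ℝ ∞ u p) :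
    ContDiffAt ℝ ∞ (dx u) p :=
  (hu.fderiv_right (m := ∞) (by simp)).clm_apply contDiffAt_const

/-- The map `β ↦ β̂` as a real-linear map. -/
noncomputable def hatL (s : ℝ) : ℂ →L[ℝ] ℂ :=
  if 0 < s then ContinuousLinearMap.id ℝ ℂ else Complex.conjCLE

theorem hatL_apply (s : ℝ) (β : ℂ) : hatL s β = hat s β := by
  unfold hatL hat
  split_ifs <;> simp

theorem hat_mul (s : ℝ) (a b : ℂ) : hat s (a * b) = hat s a * hat s b := by
  unfold hat
  split_ifs <;> simp

theorem hat_add (s : ℝ) (a b : ℂ) : hat s (a + b) = hat s a + hat s b := by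
  unfold hat
  split_ifs <;> simp

theorem hat_hat (s : ℝ) (a : ℂ) : hat s (hat s a) = a := by
  unfold hat
  split_ifs <;> simp

theorem hat_eq_zero {s : ℝ} {a : ℂ} : hat s a = 0 ↔ a = 0 := by
  unfold hat
  split_ifs <;> simp

theorem hat_I {s : ℝ} (hs : s ≠ 0) : hat s Complex.I = Real.sign s * Complex.I := by
  unfold hat
  split_ifs with h
  · simp [Real.sign_of_pos h]
  · simp [Real.sign_of_neg (lt_of_le_of_ne (not_lt.1 h) hs)]

theorem hat_eq_of_sign_eq {s s' : ℝ} (hs : s ≠ 0) (h : Real.sign s' = Real.sign s) (β : ℂ) :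
    hat s' β = hat s β := by
  unfold hat
  rcases lt_or_gt_of_ne hs with h1 | h1
  · rw [Real.sign_of_neg h1] at h
    have : ¬ 0 < s' := fun h2 => by rw [Real.sign_of_pos h2] at h; norm_num at h
    simp [this, h1.not_gt]
  · rw [Real.sign_of_pos h1] at h
    have : 0 < s' := by
      by_contra h2
      rcases (not_lt.1 h2).lt_or_eq with h3 | h3
      · rw [Real.sign_of_neg h3] at h; norm_num at h
      · rw [h3, Real.sign_zero] at h; norm_num at h
    simp [this, h1]

theorem eventually_sign_eq {E : Type*} [TopologicalSpace E] {f : E → ℝ} {p : E}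
    (hf : ContinuousAt f p) (h0 : f p ≠ 0) : ∀ᶠ q in 𝓝 p, Real.sign (f q) = Real.sign (f p) := by
  rcases lt_or_gt_of_ne h0 with h | h
  · filter_upwards [hf.eventually_lt continuousAt_const h] with q hq
    rw [Real.sign_of_neg hq, Real.sign_of_neg h]
  · filter_upwards [continuousAt_const.eventually_lt hf h] with q hq
    rw [Real.sign_of_pos hq, Real.sign_of_pos h]

theorem sign_mul_self_eq_abs (s : ℝ) : Real.sign s * s = |s| := by
  rcases lt_trichotomy s 0 with h | rfl | h
  · rw [Real.sign_of_neg h, abs_of_neg h, neg_one_mul]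
  · simp
  · rw [Real.sign_of_pos h, abs_of_pos h, one_mul]

theorem Potential.lhs_add (V : Potential) {u Φ : Base → ℂ} {p : Base} (hu : ContDiffAt ℝ ∞ u p)
    (hΦ : ContDiffAt ℝ ∞ Φ p) :
    V.lhs (fun q => u q + Φ q) p = V.lhs u p + V.lhs Φ p := by
  have h1 : (1 : WithTop ℕ∞) ≤ ∞ := mod_cast le_top
  have e1 : dx (fun q => u q + Φ q) =ᶠ[𝓝 p] fun q => dx u q + dx Φ q := by
    filter_upwards [(hu.of_le h1).eventually (by simp), (hΦ.of_le h1).eventually (by simp)]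
      with q h2 h3
    unfold dx
    rw [fderiv_fun_add (h2.differentiableAt (by simp)) (h3.differentiableAt (by simp))]
    rfl
  have e2 : dt (fun q => u q + Φ q) p = dt u p + dt Φ p := by
    unfold dt
    rw [fderiv_fun_add (hu.differentiableAt (by simp)) (hΦ.differentiableAt (by simp))]
    rfl
  have e3 : dx (dx (fun q => u q + Φ q)) p = dx (dx u) p + dx (dx Φ) p := by
    have : dx (dx (fun q => u q + Φ q)) p = dx (fun q => dx u q + dx Φ q) p := by
      rw [dx, e1.fderiv_eq, ← dx]
    rw [this, dx, fderiv_fun_add ((contDiffAt_dx hu).differentiableAt (by simp))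
      ((contDiffAt_dx hΦ).differentiableAt (by simp))]
    rfl
  unfold Potential.lhs
  rw [e2, e3]
  ring

namespace Params

variable (P : Params)

/-- The logarithmic derivative of the factor with respect to `x`. -/
noncomputable def logDerivX (p : Base) : ℂ :=
  Complex.I / 4 * ((deriv (deriv P.T) p.1 / |deriv P.T p.1| : ℝ) : ℂ) * (p.2 : ℂ)
    + Complex.I / 2 *
      ((P.eps * P.eps' p.1 * deriv P.X0 p.1 / Real.sqrt |deriv P.T p.1| : ℝ) : ℂ)

theorem hasDerivAt_factor_x (t x : ℝ) :
    HasDerivAt (fun s : ℝ => P.factor (t, s)) (P.factor (t, x) * P.logDerivX (t, x)) x := by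
  have h0 : HasDerivAt (fun s : ℝ => (s : ℂ)) 1 x := Complex.ofRealCLM.hasDerivAt
  unfold factor
  refine HasDerivAt.cexp ?_
  have := ((((h0.pow 2).const_mul (Complex.I / 8 *
    ((deriv (deriv P.T) t / |deriv P.T t| : ℝ) : ℂ))).add (h0.const_mul (Complex.I / 2 *
        ((P.eps * P.eps' t * deriv P.X0 t / Real.sqrt |deriv P.T t| : ℝ) : ℂ)))).add_const
        (Complex.I * (P.sigma t : ℂ))).add_const (P.upsilon t : ℂ)
  refine this.congr_deriv ?_
  simp [logDerivX]
  ring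

theorem hasDerivAt_logDerivX_x (t x : ℝ) :
    HasDerivAt (fun s : ℝ => P.logDerivX (t, s))
      (Complex.I / 4 * ((deriv (deriv P.T) t / |deriv P.T t| : ℝ) : ℂ)) x := by
  have h0 : HasDerivAt (fun s : ℝ => (s : ℂ)) 1 x := Complex.ofRealCLM.hasDerivAt
  unfold logDerivX
  refine ((h0.const_mul (Complex.I / 4 *
    ((deriv (deriv P.T) t / |deriv P.T t| : ℝ) : ℂ))).add_const (Complex.I / 2 *
      ((P.eps * P.eps' t * deriv P.X0 t / Real.sqrt |deriv P.T t| : ℝ) : ℂ))).congr_deriv ?_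
  rw [mul_one]

theorem hasDerivAt_baseMap_x (t x : ℝ) :
    HasDerivAt (fun s : ℝ => P.baseMap (t, s)) (0, P.eps * Real.sqrt |deriv P.T t|) x := by
  unfold baseMap
  refine (hasDerivAt_const x (P.T t)).prodMk ?_
  simpa using ((hasDerivAt_id x).const_mul (P.eps * Real.sqrt |deriv P.T t|)).add_const (P.X0 t)

/-- The requirements on the parameter functions of `t`, at one point `t`. -/
structure RegularAt (t : ℝ) : Prop where
  T : ContDiffAt ℝ ∞ P.T t
  X0 : ContDiffAt ℝ ∞ P.X0 t
  sigma : ContDiffAt ℝ ∞ P.sigma t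
  upsilon : ContDiffAt ℝ ∞ P.upsilon t
  ne_zero : deriv P.T t ≠ 0
  eps : P.eps = 1 ∨ P.eps = -1

end Params

theorem contDiffAt_ofReal {E : Type*} [NormedAddCommGroup E] [NormedSpace ℝ E] {f : E → ℝ} {p : E}
    (hf : ContDiffAt ℝ ∞ f p) : ContDiffAt ℝ ∞ (fun q => (f q : ℂ)) p :=
  Complex.ofRealCLM.contDiff.contDiffAt.comp p hf

theorem contDiffAt_deriv {f : ℝ → ℝ} {t : ℝ} (hf : ContDiffAt ℝ ∞ f t) :
    ContDiffAt ℝ ∞ (deriv f) t :=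
  (hf.fderiv_right (m := ∞) (by simp)).clm_apply contDiffAt_const

namespace Params

variable {P : Params} {t : ℝ}

theorem RegularAt.contDiffAt_sqrt (h : P.RegularAt t) :
    ContDiffAt ℝ ∞ (fun s => Real.sqrt |deriv P.T s|) t :=
  ((contDiffAt_deriv h.T).abs h.ne_zero).sqrt (abs_ne_zero.2 h.ne_zero)

theorem RegularAt.contDiffAt_baseMap {p : Base} (h : P.RegularAt p.1) :
    ContDiffAt ℝ ∞ P.baseMap p := by
  have h1 : ContDiffAt ℝ ∞ (fun q : Base => q.1) p := contDiffAt_fst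
  have h2 := h.contDiffAt_sqrt.comp p h1
  exact (h.T.comp p h1).prodMk (((contDiffAt_const.mul h2).mul contDiffAt_snd).add
    (h.X0.comp p h1))

theorem RegularAt.contDiffAt_eps' (h : P.RegularAt t) : ContDiffAt ℝ ∞ P.eps' t := by
  refine (contDiffAt_const (c := P.eps' t)).congr_of_eventuallyEq ?_
  exact eventually_sign_eq (contDiffAt_deriv h.T).continuousAt h.ne_zero

theorem RegularAt.contDiffAt_factor {p : Base} (h : P.RegularAt p.1) :
    ContDiffAt ℝ ∞ P.factor p := by
  have h1 : ContDiffAt ℝ ∞ (fun q : Base => q.1) p := contDiffAt_fst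
  have hx : ContDiffAt ℝ ∞ (fun q : Base => (q.2 : ℂ)) p := contDiffAt_ofReal contDiffAt_snd
  have hT := contDiffAt_deriv h.T
  have hk := contDiffAt_ofReal (((contDiffAt_deriv hT).div (hT.abs h.ne_zero)
    (abs_ne_zero.2 h.ne_zero)).comp p h1)
  have hm := contDiffAt_ofReal ((((contDiffAt_const.mul h.contDiffAt_eps').mul
    (contDiffAt_deriv h.X0)).div h.contDiffAt_sqrt
    (Real.sqrt_ne_zero'.2 (abs_pos.2 h.ne_zero))).comp (g := fun s => P.eps * P.eps' s *
      deriv P.X0 s / Real.sqrt |deriv P.T s|) p h1)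
  exact ((((contDiffAt_const.mul hk).mul (hx.pow 2)).add ((contDiffAt_const.mul hm).mul hx)).add
    (contDiffAt_const.mul (contDiffAt_ofReal (h.sigma.comp p h1)))).add
    (contDiffAt_ofReal (h.upsilon.comp p h1)) |>.cexp

/-- The derivative of `|T_t|^{1/2}`. -/
theorem RegularAt.hasDerivAt_sqrt (h : P.RegularAt t) :
    HasDerivAt (fun s => Real.sqrt |deriv P.T s|)
      (P.eps' t * deriv (deriv P.T) t / (2 * Real.sqrt |deriv P.T t|)) t := by
  have h1 : HasDerivAt (deriv P.T) (deriv (deriv P.T) t) t :=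
    ((contDiffAt_deriv h.T).differentiableAt (by simp)).hasDerivAt
  have h2 := ((h1.const_mul (P.eps' t)).sqrt (by
    unfold eps'
    rw [sign_mul_self_eq_abs]
    exact abs_ne_zero.2 h.ne_zero))
  have h3 : ∀ᶠ s in 𝓝 t, P.eps' t * deriv P.T s = |deriv P.T s| := by
    filter_upwards [eventually_sign_eq (contDiffAt_deriv h.T).continuousAt h.ne_zero] with s hs
    unfold eps'
    rw [← hs, sign_mul_self_eq_abs]
  refine (h2.congr_of_eventuallyEq ?_).congr_deriv ?_
  · filter_upwards [h3] with s hs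
    rw [hs]
  · rw [h3.self_of_nhds]

theorem eps'_eq (h : deriv P.T t ≠ 0) : P.eps' t = 1 ∨ P.eps' t = -1 := by
  unfold eps'
  rcases lt_or_gt_of_ne h with h | h
  · exact Or.inr (Real.sign_of_neg h)
  · exact Or.inl (Real.sign_of_pos h)

theorem RegularAt.hasDerivAt_baseMap_t (h : P.RegularAt t) (x : ℝ) :
    HasDerivAt (fun s : ℝ => P.baseMap (s, x)) (deriv P.T t,
      P.eps * (P.eps' t * deriv (deriv P.T) t / (2 * Real.sqrt |deriv P.T t|)) * x
        + deriv P.X0 t) t :=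
  (h.T.differentiableAt (by simp)).hasDerivAt.prodMk
    (((h.hasDerivAt_sqrt.const_mul P.eps).mul_const x).add
      (h.X0.differentiableAt (by simp)).hasDerivAt)

/-- The time derivative of the factor, in terms of `r = |T_t|^{1/2}` and the sign `ε'`. -/
theorem RegularAt.hasDerivAt_factor_t (h : P.RegularAt t) (x : ℝ) {r : ℝ}
    (hr : r = Real.sqrt |deriv P.T t|) :
    HasDerivAt (fun s : ℝ => P.factor (s, x)) (P.factor (t, x) *
      (Complex.I / 8 * ((P.eps' t * deriv (deriv (deriv P.T)) t / (P.eps' t * r ^ 2)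
          - P.eps' t * deriv (deriv P.T) t ^ 2 / r ^ 4 : ℝ) : ℂ) * (x : ℂ) ^ 2
        + Complex.I / 2 * ((P.eps * P.eps' t * (deriv (deriv P.X0) t / r
          - deriv P.X0 t * (P.eps' t * deriv (deriv P.T) t / (2 * r)) / r ^ 2) : ℝ) : ℂ) * (x : ℂ)
        + Complex.I * ((deriv P.sigma t : ℝ) : ℂ) + ((deriv P.upsilon t : ℝ) : ℂ))) t := by
  set e := P.eps' t with he
  have he0 : e ≠ 0 := by rcases eps'_eq h.ne_zero with h1 | h1 <;> rw [he, h1] <;> norm_num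
  have hr0 : r ≠ 0 := by
    rw [hr]
    exact Real.sqrt_ne_zero'.2 (abs_pos.2 h.ne_zero)
  have hsign := eventually_sign_eq (contDiffAt_deriv h.T).continuousAt h.ne_zero
  have habs : ∀ᶠ s in 𝓝 t, |deriv P.T s| = e * deriv P.T s := by
    filter_upwards [hsign] with s hs
    rw [he, eps', ← hs, sign_mul_self_eq_abs]
  have hr2 : e * deriv P.T t = r ^ 2 := by
    rw [hr, Real.sq_sqrt (abs_nonneg _), habs.self_of_nhds]
  have d1 : HasDerivAt (deriv P.T) (deriv (deriv P.T) t) t :=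
    ((contDiffAt_deriv h.T).differentiableAt (by simp)).hasDerivAt
  have d2 : HasDerivAt (deriv (deriv P.T)) (deriv (deriv (deriv P.T)) t) t :=
    ((contDiffAt_deriv (contDiffAt_deriv h.T)).differentiableAt (by simp)).hasDerivAt
  have dX : HasDerivAt (deriv P.X0) (deriv (deriv P.X0) t) t :=
    ((contDiffAt_deriv h.X0).differentiableAt (by simp)).hasDerivAt
  have dS := (h.sigma.differentiableAt (by simp)).hasDerivAt
  have dY := (h.upsilon.differentiableAt (by simp)).hasDerivAt
  have dk : HasDerivAt (fun s => deriv (deriv P.T) s / |deriv P.T s|)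
      (e * deriv (deriv (deriv P.T)) t / (e * r ^ 2) - e * deriv (deriv P.T) t ^ 2 / r ^ 4) t := by
    refine ((d2.div (d1.const_mul e) (by rw [hr2]; exact pow_ne_zero 2 hr0)).congr_of_eventuallyEq
      ?_).congr_deriv ?_
    · filter_upwards [habs] with s hs
      simp [hs]
    · rw [hr2]
      field_simp
  have dm : HasDerivAt (fun s => P.eps * P.eps' s * deriv P.X0 s / Real.sqrt |deriv P.T s|)
      (P.eps * e * (deriv (deriv P.X0) t / r
        - deriv P.X0 t * (e * deriv (deriv P.T) t / (2 * r)) / r ^ 2)) t := by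
    refine (((dX.const_mul (P.eps * e)).div h.hasDerivAt_sqrt (hr ▸ hr0)).congr_of_eventuallyEq
      ?_).congr_deriv ?_
    · filter_upwards [hsign] with s hs
      simp [he, eps', hs]
    · rw [← hr, ← he]
      field_simp
  have hc := ((((dk.ofReal_comp.const_mul (Complex.I / 8)).mul_const ((x : ℂ) ^ 2)).add
    ((dm.ofReal_comp.const_mul (Complex.I / 2)).mul_const (x : ℂ))).add
    (dS.ofReal_comp.const_mul Complex.I)).add dY.ofReal_comp
  exact hc.cexp

end Params

/-- The transformation rule for the equation, as an identity between complex numbers: `A` is the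
factor, `h` the transformed unknown function, `w` the value of the new potential. -/
theorem transformation_identity {e ε r x τ₂ τ₃ X₁ X₂ S Y A h ht hx hxx v w vt vx vxx : ℂ}
    (he : e = 1 ∨ e = -1) (hε : ε = 1 ∨ ε = -1) (hr : r ≠ 0)
    (h1 : vx * (ε * r) = A * (Complex.I / 4 * (τ₂ / r ^ 2) * x
      + Complex.I / 2 * (ε * e * X₁ / r)) * h + A * hx)
    (h2 : vxx * (ε * r) * (ε * r) = A * (Complex.I / 4 * (τ₂ / r ^ 2) * x
      + Complex.I / 2 * (ε * e * X₁ / r)) * ((Complex.I / 4 * (τ₂ / r ^ 2) * x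
      + Complex.I / 2 * (ε * e * X₁ / r)) * h + hx)
      + A * (Complex.I / 4 * (τ₂ / r ^ 2) * h + (Complex.I / 4 * (τ₂ / r ^ 2) * x
      + Complex.I / 2 * (ε * e * X₁ / r)) * hx + hxx))
    (h3 : e * r ^ 2 * vt + (ε * (e * τ₂ / (2 * r)) * x + X₁) * vx =
      A * (Complex.I / 8 * (e * τ₃ / (e * r ^ 2) - e * τ₂ ^ 2 / r ^ 4) * x ^ 2
        + Complex.I / 2 * (ε * e * (X₂ / r - X₁ * (e * τ₂ / (2 * r)) / r ^ 2)) * x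
        + Complex.I * S + Y) * h + A * ht) :
    Complex.I * vt + vxx + w * (A * h) =
      A / r ^ 2 * (e * Complex.I * ht + hxx + v * h)
      + A * (w - (v / r ^ 2
        + (2 * τ₃ * (e * r ^ 2) - 3 * τ₂ ^ 2) / (16 * e * (e * r ^ 2) ^ 3) * x ^ 2
        + ε * e / (2 * r) * ((X₂ * (e * r ^ 2) - X₁ * τ₂) / (e * r ^ 2) ^ 2) * x
        - (Complex.I * τ₂ + X₁ ^ 2) / (4 * (e * r ^ 2) ^ 2)
        + (S - Complex.I * Y) / (e * r ^ 2))) * h := by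
  have hε0 : ε ≠ 0 := by rcases hε with rfl | rfl <;> simp
  have he0 : e ≠ 0 := by rcases he with rfl | rfl <;> simp
  have e1 : vx = _ := eq_div_of_mul_eq (mul_ne_zero hε0 hr) h1
  have e2 : vxx = _ := eq_div_of_mul_eq (mul_ne_zero hε0 hr)
    (eq_div_of_mul_eq (mul_ne_zero hε0 hr) h2)
  have e3 : vt = _ := eq_div_of_mul_eq (mul_ne_zero he0 (pow_ne_zero 2 hr))
    ((mul_comm _ _).trans (eq_sub_of_add_eq h3))
  rw [e3, e2, e1]
  have hI : Complex.I ^ 2 = -1 := Complex.I_sq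
  rcases he with rfl | rfl <;> rcases hε with rfl | rfl <;> field_simp <;> ring_nf <;>
    simp only [hI] <;> ring

/-- If `v` is the image of `u` under the transformation with parameters `P`, then the left-hand side
of the equation with potential `W` at `v` is a nonvanishing multiple of that of the equation with
potential `V` at `u + Φ`, up to a term that vanishes if `W` is the transformed potential. -/
theorem Params.RegularAt.lhs_transformed {P : Params} {p : Base} (hP : P.RegularAt p.1)
    (V W : Potential) {u v : Base → ℂ} (hu : ContDiffAt ℝ ∞ u p) (hΦ : ContDiffAt ℝ ∞ P.Phi p)
    (hv : ContDiffAt ℝ ∞ v (P.baseMap p))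
    (h : ∀ᶠ q in 𝓝 p, v (P.baseMap q) =
      P.factor q * (hat (deriv P.T q.1) (u q) + hat (deriv P.T q.1) (P.Phi q))) :
    W.lhs v (P.baseMap p) =
      P.factor p / (|deriv P.T p.1| : ℝ) *
          hat (deriv P.T p.1) (V.lhs u p + V.lhs P.Phi p)
        + P.factor p * (W.toFun (P.baseMap p) - P.newPotential V p) *
          hat (deriv P.T p.1) (u p + P.Phi p) := by
  obtain ⟨t, x⟩ := p
  simp only at hP
  set H := hatL (deriv P.T t) with hH
  set g : Base → ℂ := fun q => u q + P.Phi q with hg_def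
  have hg : ContDiffAt ℝ ∞ g (t, x) := hu.add hΦ
  have h1le : (1 : WithTop ℕ∞) ≤ ∞ := mod_cast le_top
  have hTc : ContinuousAt (fun q : Base => deriv P.T q.1) (t, x) :=
    ContinuousAt.comp (f := Prod.fst) (g := deriv P.T) (contDiffAt_deriv hP.T).continuousAt
      continuousAt_fst
  have h' : ∀ᶠ q in 𝓝 ((t, x) : Base), v (P.baseMap q) = P.factor q * H (g q) := by
    filter_upwards [h, eventually_sign_eq hTc hP.ne_zero] with q h1 h2
    rw [h1, hH, hatL_apply, ← hat_eq_of_sign_eq hP.ne_zero h2, hg_def, hat_add]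
  have hF : ContDiffAt ℝ ∞ P.baseMap (t, x) := hP.contDiffAt_baseMap
  have hv1 : ∀ᶠ q in 𝓝 ((t, x) : Base), DifferentiableAt ℝ v (P.baseMap q) :=
    hF.continuousAt.eventually (((hv.of_le h1le).eventually (by simp)).mono
      fun y hy => hy.differentiableAt (by simp))
  have hg1 : ∀ᶠ q in 𝓝 ((t, x) : Base), DifferentiableAt ℝ g q :=
    ((hg.of_le h1le).eventually (by simp)).mono fun y hy => hy.differentiableAt (by simp)
  have hcx : ∀ q : Base, ContinuousAt (fun s : ℝ => ((q.1, s) : Base)) q.2 := fun q => by fun_prop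
  -- the first derivative with respect to `x`, near the point
  have hx : ∀ᶠ q in 𝓝 ((t, x) : Base),
      (P.eps * Real.sqrt |deriv P.T q.1| : ℝ) * dx v (P.baseMap q)
        = P.factor q * P.logDerivX q * H (g q) + P.factor q * H (dx g q) := by
    filter_upwards [h'.eventually_nhds, hv1, hg1] with q h1 h2 h3
    have e1 := hasDerivAt_comp_curve (u := v) (c := fun s => P.baseMap (q.1, s)) (s := q.2) h2
      (P.hasDerivAt_baseMap_x q.1 q.2)
    have e2 := (P.hasDerivAt_factor_x q.1 q.2).mul (H.hasFDerivAt.comp_hasDerivAt q.2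
      (hasDerivAt_slice_x h3))
    have e3 : (fun s => v (P.baseMap (q.1, s))) =ᶠ[𝓝 q.2]
        fun s => P.factor (q.1, s) * H (g (q.1, s)) := (hcx q).eventually h1
    have e4 := e1.unique (e2.congr_of_eventuallyEq e3)
    simpa using e4
  have hv0 : DifferentiableAt ℝ v (P.baseMap (t, x)) := hv1.self_of_nhds
  have hg0 : DifferentiableAt ℝ g (t, x) := hg1.self_of_nhds
  have hvx0 := (contDiffAt_dx hv).differentiableAt (by simp)
  have hgx0 := (contDiffAt_dx hg).differentiableAt (by simp)
  have k1 := hx.self_of_nhds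
  -- the second derivative with respect to `x`
  have k2 : (P.eps * Real.sqrt |deriv P.T t| : ℝ) *
      ((P.eps * Real.sqrt |deriv P.T t| : ℝ) * dx (dx v) (P.baseMap (t, x))) =
      (P.factor (t, x) * P.logDerivX (t, x) * P.logDerivX (t, x) + P.factor (t, x) *
        (Complex.I / 4 * ((deriv (deriv P.T) t / |deriv P.T t| : ℝ) : ℂ))) * H (g (t, x))
        + P.factor (t, x) * P.logDerivX (t, x) * H (dx g (t, x))
        + (P.factor (t, x) * P.logDerivX (t, x) * H (dx g (t, x))
        + P.factor (t, x) * H (dx (dx g) (t, x))) := by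
    have e1 := (hasDerivAt_comp_curve (u := dx v) (c := fun s => P.baseMap (t, s)) (s := x) hvx0
      (P.hasDerivAt_baseMap_x t x)).const_mul ((P.eps * Real.sqrt |deriv P.T t| : ℝ) : ℂ)
    have e2 := (((P.hasDerivAt_factor_x t x).mul (P.hasDerivAt_logDerivX_x t x)).mul
      (H.hasFDerivAt.comp_hasDerivAt x (hasDerivAt_slice_x hg0))).add
      ((P.hasDerivAt_factor_x t x).mul (H.hasFDerivAt.comp_hasDerivAt x (hasDerivAt_slice_x hgx0)))
    have e3 := (hcx (t, x)).eventually hx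
    have e4 := e1.unique (e2.congr_of_eventuallyEq e3)
    simpa using e4
  -- the derivative with respect to `t`
  have k3 : ((deriv P.T t : ℝ) : ℂ) * dt v (P.baseMap (t, x))
      + ((P.eps * (P.eps' t * deriv (deriv P.T) t / (2 * Real.sqrt |deriv P.T t|)) * x
        + deriv P.X0 t : ℝ) : ℂ) * dx v (P.baseMap (t, x)) =
      P.factor (t, x) * (Complex.I / 8 * ((P.eps' t * deriv (deriv (deriv P.T)) t /
            (P.eps' t * Real.sqrt |deriv P.T t| ^ 2)
          - P.eps' t * deriv (deriv P.T) t ^ 2 / Real.sqrt |deriv P.T t| ^ 4 : ℝ) : ℂ) * (x : ℂ) ^ 2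
        + Complex.I / 2 * ((P.eps * P.eps' t * (deriv (deriv P.X0) t / Real.sqrt |deriv P.T t|
          - deriv P.X0 t * (P.eps' t * deriv (deriv P.T) t / (2 * Real.sqrt |deriv P.T t|))
            / Real.sqrt |deriv P.T t| ^ 2) : ℝ) : ℂ) * (x : ℂ)
        + Complex.I * ((deriv P.sigma t : ℝ) : ℂ) + ((deriv P.upsilon t : ℝ) : ℂ)) * H (g (t, x))
      + P.factor (t, x) * H (dt g (t, x)) := by
    have e1 := hasDerivAt_comp_curve (u := v) (c := fun s => P.baseMap (s, x)) (s := t) hv0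
      (hP.hasDerivAt_baseMap_t x)
    have e2 := (hP.hasDerivAt_factor_t x rfl).mul (H.hasFDerivAt.comp_hasDerivAt t
      (hasDerivAt_slice_t hg0))
    have hct : ContinuousAt (fun s : ℝ => ((s, x) : Base)) t := by fun_prop
    have e3 : (fun s => v (P.baseMap (s, x))) =ᶠ[𝓝 t]
        fun s => P.factor (s, x) * H (g (s, x)) := hct.eventually h'
    exact e1.unique (e2.congr_of_eventuallyEq e3)
  have k0 := h'.self_of_nhds
  have hq : deriv (fun s => deriv P.X0 s / deriv P.T s) t =
      (deriv (deriv P.X0) t * deriv P.T t - deriv P.X0 t * deriv (deriv P.T) t)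
        / deriv P.T t ^ 2 :=
    deriv_fun_div ((contDiffAt_deriv hP.X0).differentiableAt (by simp))
      ((contDiffAt_deriv hP.T).differentiableAt (by simp)) hP.ne_zero
  have hL : V.lhs u (t, x) + V.lhs P.Phi (t, x) =
      Complex.I * dt g (t, x) + dx (dx g) (t, x) + V.toFun (t, x) * g (t, x) := by
    rw [← V.lhs_add hu hΦ]
    rfl
  set r := Real.sqrt |deriv P.T t| with hr
  have hr0 : r ≠ 0 := Real.sqrt_ne_zero'.2 (abs_pos.2 hP.ne_zero)
  have hr2 : |deriv P.T t| = r ^ 2 := (Real.sq_sqrt (abs_nonneg _)).symm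
  have he : Real.sign (deriv P.T t) = 1 ∨ Real.sign (deriv P.T t) = -1 := eps'_eq hP.ne_zero
  have hT : deriv P.T t = Real.sign (deriv P.T t) * r ^ 2 := by
    rw [← hr2, ← sign_mul_self_eq_abs]
    rcases he with h1 | h1 <;> rw [h1] <;> norm_num
  have hhI := hat_I hP.ne_zero
  unfold Params.newPotential Params.logDerivX Potential.lhs at *
  simp only [hL, hat_add, hat_mul, hhI, hq, k0]
  have hrr : Real.sqrt (r ^ 2) = r := Real.sqrt_sq (Real.sqrt_nonneg _)
  simp only [Params.eps', hr2, hrr, ← hatL_apply, ← hH] at k1 k2 k3 ⊢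
  rw [← map_add]
  have hgp : u (t, x) + P.Phi (t, x) = g (t, x) := rfl
  rw [hgp]
  generalize Real.sign (deriv P.T t) = e at *
  clear_value H r
  rw [hT] at k3 ⊢
  have he' : (e : ℂ) = 1 ∨ (e : ℂ) = -1 := by exact_mod_cast he
  have hε' : (P.eps : ℂ) = 1 ∨ (P.eps : ℂ) = -1 := by exact_mod_cast hP.eps
  have hr' : (r : ℂ) ≠ 0 := by exact_mod_cast hr0
  push_cast at k1 k2 k3 ⊢
  exact transformation_identity (h := H (g (t, x))) (hx := H (dx g (t, x)))
    (hxx := H (dx (dx g) (t, x))) he' hε' hr' (by linear_combination k1)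
    (by linear_combination k2) k3

/-! ### Transformations of the explicit form -/

theorem isOpen_times {Ω : Set Total} (hΩ : IsOpen Ω) : IsOpen (times Ω) :=
  (isOpenMap_fst.comp isOpenMap_fst) Ω hΩ

theorem isOpen_base {Ω : Set Total} (hΩ : IsOpen Ω) : IsOpen (base Ω) :=
  isOpenMap_fst Ω hΩ

namespace Params

variable {P : Params}

theorem IsValidOn.regularAt {V : Potential} {Ω : Set Total} (hP : P.IsValidOn V Ω)
    (hΩ : IsOpen Ω) {t : ℝ} (ht : t ∈ times Ω) : P.RegularAt t := by
  obtain ⟨-, hT, hX, hS, hY, hT0, hε, -⟩ := hP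
  have hn := (isOpen_times hΩ).mem_nhds ht
  exact ⟨hT.contDiffAt hn, hX.contDiffAt hn, hS.contDiffAt hn, hY.contDiffAt hn, hT0 t ht, hε⟩

theorem IsValidOn.contDiffAt_Phi {V : Potential} {Ω : Set Total} (hP : P.IsValidOn V Ω)
    (hΩ : IsOpen Ω) {p : Base} (hp : p ∈ base Ω) : ContDiffAt ℝ ∞ P.Phi p :=
  hP.2.2.2.2.2.2.2.1.contDiffAt ((isOpen_base hΩ).mem_nhds hp)

theorem factor_ne_zero (p : Base) : P.factor p ≠ 0 := Complex.exp_ne_zero _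

theorem map_eq (z : Total) :
    P.map z = (P.baseMap z.1, P.factor z.1 * hat (deriv P.T z.1.1) (z.2 + P.Phi z.1)) := by
  rw [hat_add]
  rfl

end Params

theorem mem_times_of_mem_base {Ω : Set Total} {p : Base} (hp : p ∈ base Ω) : p.1 ∈ times Ω := by
  obtain ⟨z, hz, rfl⟩ := hp
  exact ⟨z, hz, rfl⟩

/-- A transformation that has the explicit form near every point is admissible. -/
theorem mem_equivalenceGroupoid_of_hasForm {V W : Potential} {φ : PointTransformation}
    (h : ∀ z ∈ φ.source, ∃ N : Set Total, IsOpen N ∧ z ∈ N ∧ N ⊆ φ.source ∧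
      ∃ P : Params, HasForm V W φ P N) : (V, W, φ) ∈ equivalenceGroupoid := by
  refine ⟨fun z hz => ?_, fun z hz => ?_, ?_⟩
  · obtain ⟨N, -, hzN, -, P, hP, -, -⟩ := h z hz
    exact hP.1 ⟨z, hzN, rfl⟩
  · obtain ⟨N, -, hzN, -, P, -, hφ, hW⟩ := h z hz
    simp only
    rw [hφ hzN]
    exact (hW z.1 ⟨z, hzN, rfl⟩).1
  · intro p u v hz hu _ hv hvu
    obtain ⟨N, hN, hzN, -, P, hP, hφ, hW⟩ := h _ hz
    have hp : p ∈ base N := ⟨_, hzN, rfl⟩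
    have hreg := hP.regularAt hN (mem_times_of_mem_base hp)
    have hc : ContinuousAt (fun q => ((q, u q) : Total)) p := continuousAt_id.prodMk hu.continuousAt
    have hF : (φ.toFun (p, u p)).1 = P.baseMap p := by
      rw [hφ hzN]
      rfl
    have hrel : ∀ᶠ q in 𝓝 p, v (P.baseMap q) =
        P.factor q * (hat (deriv P.T q.1) (u q) + hat (deriv P.T q.1) (P.Phi q)) := by
      filter_upwards [hvu, hc.eventually (hN.mem_nhds hzN)] with q h1 h2
      rw [hφ h2] at h1
      exact h1
    rw [hF] at hv ⊢
    have key := hreg.lhs_transformed V W hu (hP.contDiffAt_Phi hN hp) hv hrel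
    rw [key, (hW p hp).2, hP.2.2.2.2.2.2.2.2 p hp, sub_self, mul_zero, zero_mul, add_zero,
      add_zero, mul_eq_zero, hat_eq_zero]
    have h1 : P.factor p / (|deriv P.T p.1| : ℝ) ≠ 0 :=
      div_ne_zero (Params.factor_ne_zero p) (by exact_mod_cast abs_ne_zero.2 hreg.ne_zero)
    simp [h1]

namespace Params

variable {P : Params}

theorem RegularAt.fderiv_baseMap {p : Base} (h : P.RegularAt p.1) :
    (∀ c : Base, (fderiv ℝ P.baseMap p c).1 = deriv P.T p.1 * c.1) ∧
      fderiv ℝ P.baseMap p (0, 1) = (0, P.eps * Real.sqrt |deriv P.T p.1|) := by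
  have hd : HasFDerivAt P.baseMap (fderiv ℝ P.baseMap p) p :=
    (h.contDiffAt_baseMap.differentiableAt (by simp)).hasFDerivAt
  constructor
  · intro c
    have h1 := hd.fst
    have hT : HasDerivAt P.T (deriv P.T p.1) p.1 := (h.T.differentiableAt (by simp)).hasDerivAt
    have h2 : HasFDerivAt (fun q : Base => P.T q.1) _ p :=
      hT.hasFDerivAt.comp (f := Prod.fst) p hasFDerivAt_fst
    have h3 := DFunLike.congr_fun (h1.unique h2) c
    simpa [mul_comm] using h3
  · have hc : HasDerivAt (fun s : ℝ => ((p.1, s) : Base)) (0, 1) p.2 :=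
      (hasDerivAt_const p.2 p.1).prodMk (hasDerivAt_id p.2)
    have h1 := hd.comp_hasDerivAt (f := fun s : ℝ => ((p.1, s) : Base)) p.2 hc
    exact h1.unique (P.hasDerivAt_baseMap_x p.1 p.2)

theorem RegularAt.eps_mul_sqrt_ne_zero {t : ℝ} (h : P.RegularAt t) :
    P.eps * Real.sqrt |deriv P.T t| ≠ 0 := by
  refine mul_ne_zero ?_ (Real.sqrt_ne_zero'.2 (abs_pos.2 h.ne_zero))
  rcases h.eps with h1 | h1 <;> rw [h1] <;> norm_num

theorem RegularAt.injective_fderiv_baseMap {p : Base} (h : P.RegularAt p.1) :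
    Function.Injective (fderiv ℝ P.baseMap p) := by
  rw [injective_iff_map_eq_zero]
  rintro ⟨a, b⟩ h0
  obtain ⟨h1, h2⟩ := h.fderiv_baseMap
  have ha : a = 0 := by
    have h3 := h1 (a, b)
    rw [h0] at h3
    simpa [h.ne_zero] using h3
  subst ha
  have h3 : ((0, b) : Base) = b • (0, 1) := by simp
  rw [h3, map_smul, h2] at h0
  have h4 := congrArg Prod.snd h0
  have h5 : b = 0 := by simpa [h.eps_mul_sqrt_ne_zero] using h4
  rw [h5]
  rfl

theorem RegularAt.bijective_fderiv_baseMap {p : Base} (h : P.RegularAt p.1) :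
    Function.Bijective (fderiv ℝ P.baseMap p) :=
  ⟨h.injective_fderiv_baseMap, (LinearMap.injective_iff_surjective
    (f := (fderiv ℝ P.baseMap p).toLinearMap)).1 h.injective_fderiv_baseMap⟩

theorem RegularAt.contDiffAt_map {z : Total} (h : P.RegularAt z.1.1)
    (hΦ : ContDiffAt ℝ ∞ P.Phi z.1) : ContDiffAt ℝ ∞ P.map z := by
  have h1 : ContDiffAt ℝ ∞ (fun y : Total => y.1) z := contDiffAt_fst
  have hs : ContDiffAt ℝ ∞ (fun y : Total => (P.baseMap y.1,
      P.factor y.1 * hatL (deriv P.T z.1.1) (y.2 + P.Phi y.1))) z :=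
    (h.contDiffAt_baseMap.comp z h1).prodMk ((h.contDiffAt_factor.comp z h1).mul
      ((hatL _).contDiff.contDiffAt.comp z (contDiffAt_snd.add (hΦ.comp z h1))))
  refine hs.congr_of_eventuallyEq ?_
  have hc : ContinuousAt (fun y : Total => deriv P.T y.1.1) z :=
    ContinuousAt.comp (f := fun y : Total => y.1.1) (g := deriv P.T)
      (contDiffAt_deriv h.T).continuousAt (by fun_prop)
  filter_upwards [eventually_sign_eq hc h.ne_zero] with y hy
  rw [map_eq, hatL_apply, hat_eq_of_sign_eq h.ne_zero hy]

theorem RegularAt.bijective_fderiv_map {z : Total} (h : P.RegularAt z.1.1)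
    (hΦ : ContDiffAt ℝ ∞ P.Phi z.1) : Function.Bijective (fderiv ℝ P.map z) := by
  have hinj : Function.Injective (fderiv ℝ P.map z) := by
    have hd : HasFDerivAt P.map (fderiv ℝ P.map z) z :=
      ((h.contDiffAt_map hΦ).differentiableAt (by simp)).hasFDerivAt
    rw [injective_iff_map_eq_zero]
    rintro ⟨c, b⟩ h0
    have hc : c = 0 := by
      have hB : HasFDerivAt P.baseMap (fderiv ℝ P.baseMap z.1) z.1 :=
        (h.contDiffAt_baseMap.differentiableAt (by simp)).hasFDerivAt
      have h1 := hd.fst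
      have h2 : HasFDerivAt (fun y : Total => P.baseMap y.1) _ z := hB.comp z hasFDerivAt_fst
      have h3 := DFunLike.congr_fun (h1.unique h2) (c, b)
      have h4 : fderiv ℝ P.baseMap z.1 c = 0 := by
        simp only [ContinuousLinearMap.comp_apply, ContinuousLinearMap.coe_fst', h0] at h3
        exact h3.symm
      exact h.injective_fderiv_baseMap (h4.trans (map_zero _).symm)
    subst hc
    have hw : HasFDerivAt (fun w : ℂ => ((z.1, w) : Total))
        (ContinuousLinearMap.inr ℝ Base ℂ) z.2 :=
      hasFDerivAt_prodMk_right z.1 z.2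
    have h1 := (hd.comp (f := fun w : ℂ => ((z.1, w) : Total)) z.2 hw).snd
    have h2 : HasFDerivAt (fun w : ℂ => (P.map (z.1, w)).2)
        (P.factor z.1 • hatL (deriv P.T z.1.1)) z.2 := by
      have h3 := (((hatL (deriv P.T z.1.1)).hasFDerivAt (x := z.2)).add_const
        (hatL (deriv P.T z.1.1) (P.Phi z.1))).const_mul (P.factor z.1)
      refine h3.congr_of_eventuallyEq (Filter.Eventually.of_forall fun w => ?_)
      simp only [hatL_apply]
      rfl
    have h3 := DFunLike.congr_fun (h1.unique h2) b
    simp only [ContinuousLinearMap.comp_apply, ContinuousLinearMap.inr_apply, h0] at h3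
    have h4 : P.factor z.1 * hat (deriv P.T z.1.1) b = 0 := by
      rw [← hatL_apply]
      simpa using h3.symm
    rw [mul_eq_zero, or_iff_right (factor_ne_zero _), hat_eq_zero] at h4
    rw [h4]
    rfl
  exact ⟨hinj, (LinearMap.injective_iff_surjective (f := (fderiv ℝ P.map z).toLinearMap)).1 hinj⟩

theorem RegularAt.contDiffAt_newPotential {p : Base} (h : P.RegularAt p.1) {V : Potential}
    (hV : ContDiffAt ℝ ∞ V.toFun p) : ContDiffAt ℝ ∞ (P.newPotential V) p := by
  have h1 : ContDiffAt ℝ ∞ (fun q : Base => q.1) p := contDiffAt_fst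
  have hx : ContDiffAt ℝ ∞ (fun q : Base => q.2) p := contDiffAt_snd
  have lift : ∀ {f : ℝ → ℝ}, ContDiffAt ℝ ∞ f p.1 → ContDiffAt ℝ ∞ (fun q : Base => f q.1) p :=
    fun hf => hf.comp p h1
  have T1 := contDiffAt_deriv h.T
  have T2 := contDiffAt_deriv T1
  have T3 := contDiffAt_deriv T2
  have X1 := contDiffAt_deriv h.X0
  have hr0 : Real.sqrt |deriv P.T p.1| ≠ 0 := Real.sqrt_ne_zero'.2 (abs_pos.2 h.ne_zero)
  have he0 : P.eps' p.1 ≠ 0 := by rcases eps'_eq h.ne_zero with h2 | h2 <;> rw [h2] <;> norm_num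
  have hT0 : ((deriv P.T p.1 : ℝ) : ℂ) ≠ 0 := by exact_mod_cast h.ne_zero
  have a1 : ContDiffAt ℝ ∞ (fun q : Base => hat (deriv P.T q.1) (V.toFun q)) p := by
    refine ((hatL (deriv P.T p.1)).contDiff.contDiffAt.comp p hV).congr_of_eventuallyEq ?_
    have hc : ContinuousAt (fun y : Base => deriv P.T y.1) p := (lift T1).continuousAt
    filter_upwards [eventually_sign_eq hc h.ne_zero] with y hy
    rw [hat_eq_of_sign_eq h.ne_zero hy, ← hatL_apply]
    rfl
  have divC : ∀ {f g : Base → ℂ}, ContDiffAt ℝ ∞ f p → ContDiffAt ℝ ∞ g p → g p ≠ 0 →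
      ContDiffAt ℝ ∞ (fun q => f q / g q) p := by
    intro f g hf hg h0
    simpa only [div_eq_mul_inv] using! hf.mul (hg.inv h0)
  have b1 := divC a1 (contDiffAt_ofReal (lift (T1.abs h.ne_zero)))
    (by exact_mod_cast abs_ne_zero.2 h.ne_zero)
  have b2 := contDiffAt_ofReal ((lift ((((contDiffAt_const (c := (2 : ℝ))).mul T3).mul T1).sub
    ((contDiffAt_const (c := (3 : ℝ))).mul (T2.pow 2)) |>.div
    (((contDiffAt_const (c := (16 : ℝ))).mul h.contDiffAt_eps').mul (T1.pow 3))
    (mul_ne_zero (mul_ne_zero (by norm_num) he0) (pow_ne_zero 3 h.ne_zero)))).mul (hx.pow 2))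
  have b3 := contDiffAt_ofReal ((lift ((((contDiffAt_const (c := P.eps)).mul h.contDiffAt_eps').div
    ((contDiffAt_const (c := (2 : ℝ))).mul h.contDiffAt_sqrt) (mul_ne_zero two_ne_zero hr0)).mul
    (contDiffAt_deriv (X1.div T1 h.ne_zero)))).mul hx)
  have b4 := divC (((contDiffAt_const (c := Complex.I)).mul (contDiffAt_ofReal (lift T2))).add
    (contDiffAt_ofReal (lift (X1.pow 2))))
    (contDiffAt_ofReal (lift ((contDiffAt_const (c := (4 : ℝ))).mul (T1.pow 2))))
    (by simp [h.ne_zero])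
  have b5 := divC ((contDiffAt_ofReal (lift (contDiffAt_deriv h.sigma))).sub
    ((contDiffAt_const (c := Complex.I)).mul
      (contDiffAt_ofReal (lift (contDiffAt_deriv h.upsilon)))))
    (contDiffAt_ofReal (lift T1)) hT0
  exact (((b1.add b2).add b3).sub b4).add b5

/-- Over a connected domain, the transformation of the independent variables is injective. -/
theorem IsValidOn.injOn_baseMap {V : Potential} {Ω : Set Total} (hP : P.IsValidOn V Ω)
    (hΩ : IsOpen Ω) (hc : IsPreconnected Ω) : Set.InjOn P.baseMap (base Ω) := by
  have hI : (times Ω).OrdConnected :=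
    (hc.image _ (by fun_prop : Continuous fun z : Total => z.1.1).continuousOn).ordConnected
  -- `T` is injective, by Rolle's theorem
  have hT : ∀ a ∈ times Ω, ∀ b ∈ times Ω, a < b → P.T a ≠ P.T b := by
    intro a ha b hb hab heq
    have hsub : Set.Icc a b ⊆ times Ω := hI.out ha hb
    obtain ⟨c, hc, hc0⟩ := exists_deriv_eq_zero hab (hP.2.1.continuousOn.mono hsub) heq
    exact hP.2.2.2.2.2.1 c (hsub (Set.Ioo_subset_Icc_self hc)) hc0
  rintro ⟨t, x⟩ hp ⟨t', x'⟩ hp' heq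
  have ht := mem_times_of_mem_base hp
  have ht' := mem_times_of_mem_base hp'
  have h1 : P.T t = P.T t' := congrArg Prod.fst heq
  have h2 : t = t' := by
    rcases lt_trichotomy t t' with h | h | h
    · exact absurd h1 (hT t ht t' ht' h)
    · exact h
    · exact absurd h1.symm (hT t' ht' t ht h)
  subst h2
  have h3 := congrArg Prod.snd heq
  have h4 := (hP.regularAt hΩ ht).eps_mul_sqrt_ne_zero
  simp only [baseMap] at h3
  rw [mul_right_injective₀ h4 (add_right_cancel h3)]

end Params

/-- All values of the parameters are realized. -/
theorem exists_hasForm (V : Potential) (Ω : Set Total) (P : Params) (hΩ : IsOpen Ω)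
    (hne : Ω.Nonempty) (hc : IsPreconnected Ω) (hP : P.IsValidOn V Ω) :
    ∃ (φ : PointTransformation) (W : Potential), φ.source = Ω ∧
      (V, W, φ) ∈ equivalenceGroupoid ∧ HasForm V W φ P Ω := by
  have hreg : ∀ p ∈ base Ω, P.RegularAt p.1 := fun p hp =>
    hP.regularAt hΩ (mem_times_of_mem_base hp)
  have hΦ : ∀ p ∈ base Ω, ContDiffAt ℝ ∞ P.Phi p := fun p hp => hP.contDiffAt_Phi hΩ hp
  have hV : ∀ p ∈ base Ω, ContDiffAt ℝ ∞ V.toFun p := fun p hp =>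
    V.smooth.contDiffAt (V.isOpen_dom.mem_nhds (hP.1 hp))
  have hinj := hP.injOn_baseMap hΩ hc
  have hbase := isOpen_base hΩ
  let φ : PointTransformation :=
    { source := Ω
      isOpen_source := hΩ
      nonempty_source := hne
      toFun := P.map
      smooth := fun z hz => ((hreg z.1 ⟨z, hz, rfl⟩).contDiffAt_map
        (hΦ z.1 ⟨z, hz, rfl⟩)).contDiffWithinAt
      nondegenerate := fun z hz => (hreg z.1 ⟨z, hz, rfl⟩).bijective_fderiv_map
        (hΦ z.1 ⟨z, hz, rfl⟩) }
  have hstrict : ∀ p ∈ base Ω, Filter.map P.baseMap (𝓝 p) = 𝓝 (P.baseMap p) := by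
    intro p hp
    have h1 := (hreg p hp).contDiffAt_baseMap.hasStrictFDerivAt (by simp)
    exact h1.map_nhds_eq_of_surj
      (LinearMap.range_eq_top.2 (hreg p hp).bijective_fderiv_baseMap.2)
  have hopen : IsOpen (P.baseMap '' base Ω) := by
    rw [isOpen_iff_mem_nhds]
    rintro _ ⟨p, hp, rfl⟩
    rw [← hstrict p hp]
    exact Filter.image_mem_map (hbase.mem_nhds hp)
  let W : Potential :=
    { dom := P.baseMap '' base Ω
      isOpen_dom := hopen
      toFun := fun q => P.newPotential V (Function.invFunOn P.baseMap (base Ω) q)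
      smooth := by
        rintro _ ⟨p, hp, rfl⟩
        -- near the image of `p`, the potential is the pullback by a smooth local inverse
        obtain ⟨v, hv, hvp⟩ := exists_contDiffAt_comp_eq (hreg p hp).contDiffAt_baseMap
          ((hreg p hp).contDiffAt_newPotential (hV p hp)) (hreg p hp).bijective_fderiv_baseMap
        refine (hv.congr_of_eventuallyEq ?_).contDiffWithinAt
        rw [← hstrict p hp, Filter.EventuallyEq, Filter.eventually_map]
        filter_upwards [hvp, hbase.mem_nhds hp] with q h1 h2
        rw [h1, hinj.leftInvOn_invFunOn h2] }
  have hform : HasForm V W φ P Ω := by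
    refine ⟨hP, fun z _ => rfl, fun p hp => ⟨⟨p, hp, rfl⟩, ?_⟩⟩
    change P.newPotential V (Function.invFunOn P.baseMap (base Ω) (P.baseMap p)) = _
    rw [hinj.leftInvOn_invFunOn hp]
  exact ⟨φ, W, rfl, mem_equivalenceGroupoid_of_hasForm
    fun z hz => ⟨Ω, hΩ, hz, subset_rfl, P, hform⟩, hform⟩

/-! ### Potentials of admissible transformations, and connected domains -/

/-- There are functions with a given value at a point that satisfy the equation at this point. -/
theorem Potential.exists_lhs_eq_zero (V : Potential) (p : Base) (w : ℂ) :
    ∃ u : Base → ℂ, ContDiff ℝ ∞ u ∧ u p = w ∧ V.lhs u p = 0 := by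
  have hQ : ∀ y y', diagForm 0 (-(V.toFun p * w)) y y' = diagForm 0 (-(V.toFun p * w)) y' y := by
    intro y y'
    simp only [diagForm_apply]
    push_cast
    ring
  refine ⟨fun q => w + (0 : Base →L[ℝ] ℂ) (q - p)
    + (1 / 2 : ℝ) • diagForm 0 (-(V.toFun p * w)) (q - p) (q - p), by fun_prop, by simp, ?_⟩
  rw [V.lhs_quadratic w p 0 _ hQ]
  simp [diagForm_apply]

/-- If a transformation given by the explicit formulas maps the one equation to the other, then `Φ`
is a solution and the new potential has the explicit form: the fibre over `p` contains two values of
`ψ`, at each of which some function satisfies the original equation. -/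
theorem PointTransformation.MapsEquation.potential_eq {φ : PointTransformation} {V W : Potential}
    (hφ : φ.MapsEquation V W) {P : Params} (hmap : Set.EqOn φ.toFun P.map φ.source) {p : Base}
    (hp : p ∈ base φ.source) (hP : P.RegularAt p.1) (hΦ : ContDiffAt ℝ ∞ P.Phi p) :
    V.lhs P.Phi p = 0 ∧ W.toFun (P.baseMap p) = P.newPotential V p := by
  have hΩ := φ.isOpen_source
  have key : ∀ w : ℂ, (p, w) ∈ φ.source →
      P.factor p / (|deriv P.T p.1| : ℝ) * hat (deriv P.T p.1) (V.lhs P.Phi p)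
        + P.factor p * (W.toFun (P.baseMap p) - P.newPotential V p) *
          hat (deriv P.T p.1) (w + P.Phi p) = 0 := by
    intro w hw
    obtain ⟨u, hu, rfl, hu0⟩ := V.exists_lhs_eq_zero p w
    have hc : ContinuousAt (fun q => ((q, u q) : Total)) p :=
      continuousAt_id.prodMk hu.continuous.continuousAt
    have hev : ∀ᶠ q in 𝓝 p, (q, u q) ∈ φ.source := hc.eventually (hΩ.mem_nhds hw)
    have hF : (fun q => (φ.toFun (q, u q)).1) =ᶠ[𝓝 p] P.baseMap := by
      filter_upwards [hev] with q hq
      rw [hmap hq]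
      rfl
    have hG : ContDiffAt ℝ ∞ (fun q => (φ.toFun (q, u q)).2) p :=
      ((φ.contDiffAt hw).comp (f := fun q => ((q, u q) : Total)) p
        (contDiffAt_id.prodMk hu.contDiffAt)).snd
    obtain ⟨v, hv, hvq⟩ := exists_contDiffAt_comp_eq hP.contDiffAt_baseMap hG
      hP.bijective_fderiv_baseMap
    have hF0 : (φ.toFun (p, u p)).1 = P.baseMap p := hF.self_of_nhds
    have h1 : W.lhs v (P.baseMap p) = 0 := by
      rw [← hF0]
      refine (hφ p u v hw hu.contDiffAt ?_ (hF0 ▸ hv) ?_).1 hu0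
      · rw [hF.fderiv_eq]
        exact hP.bijective_fderiv_baseMap
      · filter_upwards [hF, hvq] with q h2 h3
        rw [h2, h3]
    have h2 : ∀ᶠ q in 𝓝 p, v (P.baseMap q) =
        P.factor q * (hat (deriv P.T q.1) (u q) + hat (deriv P.T q.1) (P.Phi q)) := by
      filter_upwards [hvq, hev] with q h3 h4
      rw [h3, hmap h4]
      rfl
    have h3 := hP.lhs_transformed V W hu.contDiffAt hΦ hv h2
    rw [h1, hu0, zero_add] at h3
    exact h3.symm
  have hA := P.factor_ne_zero p
  have hT : ((|deriv P.T p.1| : ℝ) : ℂ) ≠ 0 := by exact_mod_cast abs_ne_zero.2 hP.ne_zero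
  obtain ⟨⟨p', w⟩, hz, rfl⟩ := hp
  -- the fibre is open, so the identity holds for two values of `ψ`
  obtain ⟨w', hw', hne⟩ : ∃ w', (p', w') ∈ φ.source ∧ w' ≠ w := by
    have hc : ContinuousAt (fun w' : ℂ => ((p', w') : Total)) w := by fun_prop
    have h1 : ∀ᶠ w' in 𝓝[≠] w, (p', w') ∈ φ.source :=
      (hc.eventually (hΩ.mem_nhds hz)).filter_mono nhdsWithin_le_nhds
    exact (h1.and self_mem_nhdsWithin).exists
  have e1 := key w hz
  have e2 := key w' hw'
  have hw : W.toFun (P.baseMap p') - P.newPotential V p' = 0 := by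
    by_contra h0
    have h1 : P.factor p' * (W.toFun (P.baseMap p') - P.newPotential V p') *
        hat (deriv P.T p'.1) (w' - w) = 0 := by
      have h2 : w' + P.Phi p' = (w' - w) + (w + P.Phi p') := by ring
      rw [h2, hat_add] at e2
      linear_combination e2 - e1
    rw [mul_eq_zero, mul_eq_zero, hat_eq_zero] at h1
    rcases h1 with (h1 | h1) | h1
    · exact hA h1
    · exact h0 h1
    · exact hne (sub_eq_zero.1 h1)
  refine ⟨?_, sub_eq_zero.1 hw⟩
  simp only at e1
  rw [hw, mul_zero, zero_mul, add_zero, mul_eq_zero, hat_eq_zero] at e1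
  exact e1.resolve_left (div_ne_zero hA hT)

theorem sign_eq_of_isPreconnected {E : Type*} [TopologicalSpace E] {S : Set E}
    (hS : IsPreconnected S) {f : E → ℝ} (hf : ∀ z ∈ S, ContinuousAt f z) (h0 : ∀ z ∈ S, f z ≠ 0)
    {y z : E} (hy : y ∈ S) (hz : z ∈ S) : Real.sign (f z) = Real.sign (f y) := by
  refine hS.induction₂ (fun a b => Real.sign (f b) = Real.sign (f a)) ?_ ?_ ?_ hy hz
  · intro a ha
    exact nhdsWithin_le_nhds (eventually_sign_eq (hf a ha) (h0 a ha))
  · intro a b c _ _ _ hab hbc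
    exact hbc.trans hab
  · intro a b _ _ h
    exact h.symm

section Connected

variable {Ω : Set Total}

theorem SliceConnected.isPreconnected_fibre (h : SliceConnected Ω) (p : Base) :
    IsPreconnected (Ω ∩ ContinuousLinearMap.fst ℝ Base ℂ ⁻¹' {p}) := by
  have h1 := (h.2.2 p).image (fun w => ((p, w) : Total)) (by fun_prop)
  convert h1 using 1
  ext ⟨q, w⟩
  simp only [Set.mem_inter_iff, Set.mem_preimage, Set.mem_image, Set.mem_ofPred_eq,
    ContinuousLinearMap.coe_fst', Set.mem_singleton_iff]
  constructor
  · rintro ⟨h2, rfl⟩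
    exact ⟨w, h2, rfl⟩
  · rintro ⟨w', h2, h3⟩
    obtain ⟨rfl, rfl⟩ := Prod.mk.inj h3
    exact ⟨h2, rfl⟩

/-- The projection `((t, x), ψ) ↦ t`. -/
noncomputable def timeProj : Total →L[ℝ] ℝ :=
  (ContinuousLinearMap.fst ℝ ℝ ℝ).comp (ContinuousLinearMap.fst ℝ Base ℂ)

theorem timeProj_apply (z : Total) : timeProj z = z.1.1 := rfl

theorem SliceConnected.isPreconnected_slice (h : SliceConnected Ω) (t : ℝ) :
    IsPreconnected (Ω ∩ timeProj ⁻¹' {t}) := by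
  have h1 := (h.2.1 t).image (fun y => (((t, y.1), y.2) : Total)) (by fun_prop)
  convert h1 using 1
  ext ⟨⟨t', x⟩, w⟩
  simp only [Set.mem_inter_iff, Set.mem_preimage, Set.mem_image, Set.mem_ofPred_eq,
    timeProj_apply, Set.mem_singleton_iff]
  constructor
  · rintro ⟨h2, rfl⟩
    exact ⟨(x, w), h2, rfl⟩
  · rintro ⟨⟨x', w'⟩, h2, h3⟩
    obtain ⟨h4, rfl⟩ := Prod.mk.inj h3
    obtain ⟨rfl, rfl⟩ := Prod.mk.inj h4
    exact ⟨h2, rfl⟩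

theorem SliceConnected.isPreconnected_base_slice (h : SliceConnected Ω) (t : ℝ) :
    IsPreconnected (base Ω ∩ ContinuousLinearMap.fst ℝ ℝ ℝ ⁻¹' {t}) := by
  have h1 := (h.isPreconnected_slice t).image (Prod.fst : Total → Base) (by fun_prop)
  convert h1 using 1
  ext p
  simp only [base, Set.mem_inter_iff, Set.mem_preimage, Set.mem_image, timeProj_apply,
    ContinuousLinearMap.coe_fst', Set.mem_singleton_iff]
  constructor
  · rintro ⟨⟨z, hz, rfl⟩, h2⟩
    exact ⟨z, ⟨hz, h2⟩, rfl⟩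
  · rintro ⟨z, ⟨hz, h2⟩, rfl⟩
    exact ⟨⟨z, hz, rfl⟩, h2⟩

theorem SliceConnected.isPreconnected_times (h : SliceConnected Ω) : IsPreconnected (times Ω) :=
  h.1.image _ (by fun_prop : Continuous fun z : Total => z.1.1).continuousOn

/-- Convex sets satisfy the connectedness assumptions. -/
theorem sliceConnected_of_convex (h : Convex ℝ Ω) : SliceConnected Ω := by
  refine ⟨h.isPreconnected, fun t => ?_, fun p => ?_⟩
  · refine Convex.isPreconnected fun y hy y' hy' a b ha hb hab => ?_
    have h1 := h hy hy' ha hb hab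
    have h2 : a * t + b * t = t := by rw [← add_mul, hab, one_mul]
    simpa [h2] using h1
  · refine Convex.isPreconnected fun y hy y' hy' a b ha hb hab => ?_
    have h1 := h hy hy' ha hb hab
    have h2 : a • p + b • p = p := by rw [← add_smul, hab, one_smul]
    simpa [h2] using h1

end Connected

/-! ### Integration of the determining equations -/

theorem PointTransformation.hasFDerivAt (φ : PointTransformation) {z : Total}
    (hz : z ∈ φ.source) : HasFDerivAt φ.toFun (fderiv ℝ φ.toFun z) z :=
  ((φ.contDiffAt hz).differentiableAt (by simp)).hasFDerivAt

/-- The derivatives of `(t̃, x̃)`, if it is given by the explicit formula. -/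
theorem PointTransformation.fst_fderiv_eq (φ : PointTransformation) {P : Params}
    (h : ∀ z ∈ φ.source, (φ.toFun z).1 = P.baseMap z.1) {z : Total} (hz : z ∈ φ.source)
    (hP : P.RegularAt z.1.1) (c : Total) :
    (fderiv ℝ φ.toFun z c).1 = fderiv ℝ P.baseMap z.1 c.1 := by
  have hB : HasFDerivAt P.baseMap (fderiv ℝ P.baseMap z.1) z.1 :=
    (hP.contDiffAt_baseMap.differentiableAt (by simp)).hasFDerivAt
  have h1 := (φ.hasFDerivAt hz).fst
  have h2 : HasFDerivAt (fun y : Total => P.baseMap y.1) _ z := hB.comp z hasFDerivAt_fst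
  have h3 : (fun y => (φ.toFun y).1) =ᶠ[𝓝 z] fun y : Total => P.baseMap y.1 := by
    filter_upwards [φ.isOpen_source.mem_nhds hz] with y hy
    exact h y hy
  exact DFunLike.congr_fun (h1.unique (h2.congr_of_eventuallyEq h3)) c

/-- The new independent variables have the form `t̃ = T`, `x̃ = ε |T_t|^{1/2} x + X⁰`. -/
theorem PointTransformation.MapsEquation.exists_baseMap_eq {φ : PointTransformation}
    {V W : Potential} (hφ : φ.MapsEquation V W) (hΩ : SliceConnected φ.source) :
    ∃ (T X0 : ℝ → ℝ) (ε : ℝ), ContDiffOn ℝ ∞ T (times φ.source) ∧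
      ContDiffOn ℝ ∞ X0 (times φ.source) ∧ (∀ t ∈ times φ.source, deriv T t ≠ 0) ∧
      (ε = 1 ∨ ε = -1) ∧
      (∀ z ∈ φ.source, deriv T z.1.1 = (fderiv ℝ φ.toFun z ((1, 0), 0)).1.1) ∧
      ∀ sigma upsilon Phi, ∀ z ∈ φ.source,
        (φ.toFun z).1 = (Params.mk T X0 sigma upsilon ε Phi).baseMap z.1 := by
  have hopen := φ.isOpen_source
  have hs : ∀ a : ℝ, timeProj ((ContinuousLinearMap.inl ℝ Base ℂ).comp
      (ContinuousLinearMap.inl ℝ ℝ ℝ) a) = a := fun a => by simp [timeProj_apply]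
  obtain ⟨T, hT, hfT⟩ := exists_contDiffOn_eq_comp timeProj _ hs hopen hΩ.isPreconnected_slice
    (f := fun z => (φ.toFun z).1.1) φ.smooth.fst.fst (by
      rintro z hz ⟨⟨t, x⟩, b⟩ hc
      rw [timeProj_apply] at hc
      simp only at hc
      subst hc
      rw [(φ.hasFDerivAt hz).fst.fst.fderiv]
      exact hφ.time_eq_zero hz x b)
  have himage : timeProj '' φ.source = times φ.source := rfl
  rw [himage] at hT
  have hmem : ∀ z ∈ φ.source, z.1.1 ∈ times φ.source := fun z hz => ⟨z, hz, rfl⟩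
  have hTat : ∀ t ∈ times φ.source, ContDiffAt ℝ ∞ T t := fun t ht =>
    hT.contDiffAt ((isOpen_times hopen).mem_nhds ht)
  have hderiv : ∀ z ∈ φ.source, deriv T z.1.1 = (fderiv ℝ φ.toFun z ((1, 0), 0)).1.1 := by
    intro z hz
    have h1 := (φ.hasFDerivAt hz).fst.fst
    have h2 : HasFDerivAt (fun y : Total => T (timeProj y)) _ z :=
      ((hTat _ (hmem z hz)).differentiableAt (by simp)).hasDerivAt.hasFDerivAt.comp z
        timeProj.hasFDerivAt
    have h3 : (fun y => (φ.toFun y).1.1) =ᶠ[𝓝 z] fun y : Total => T (timeProj y) := by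
      filter_upwards [hopen.mem_nhds hz] with y hy
      exact hfT y hy
    have h4 := DFunLike.congr_fun (h1.unique (h2.congr_of_eventuallyEq h3)) ((1, 0), 0)
    simpa [timeProj_apply] using h4.symm
  have hT0 : ∀ t ∈ times φ.source, deriv T t ≠ 0 := by
    rintro _ ⟨z, hz, rfl⟩
    change deriv T z.1.1 ≠ 0
    rw [hderiv z hz]
    exact hφ.time_deriv_ne_zero hz
  -- the sign of `D_x X` is constant
  have hX0 : ∀ z ∈ φ.source, (fderiv ℝ φ.toFun z ((0, 1), 0)).1.2 ≠ 0 := by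
    intro z hz h
    have h1 := (hφ.first_order hz).2.1
    rw [h] at h1
    exact hφ.time_deriv_ne_zero hz (by simpa using h1.symm)
  have hXc : ∀ z ∈ φ.source, ContinuousAt
      (fun z => (fderiv ℝ φ.toFun z ((0, 1), 0)).1.2) z := by
    intro z hz
    have h1 : ContinuousAt (fderiv ℝ φ.toFun) z :=
      ((φ.contDiffAt hz).fderiv_right (m := 1) (by norm_cast)).continuousAt
    exact (h1.clm_apply continuousAt_const).fst.snd
  obtain ⟨z₀, hz₀⟩ := φ.nonempty_source
  set ε := Real.sign (fderiv ℝ φ.toFun z₀ ((0, 1), 0)).1.2 with hε_def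
  have hε : ε = 1 ∨ ε = -1 := by
    rcases lt_or_gt_of_ne (hX0 z₀ hz₀) with h | h
    · exact Or.inr (Real.sign_of_neg h)
    · exact Or.inl (Real.sign_of_pos h)
  have hX : ∀ z ∈ φ.source, (fderiv ℝ φ.toFun z ((0, 1), 0)).1.2
      = ε * Real.sqrt |deriv T z.1.1| := by
    intro z hz
    rw [hderiv z hz, ← (hφ.first_order hz).2.1, Real.sqrt_sq_eq_abs, hε_def,
      ← sign_eq_of_isPreconnected hΩ.1 hXc hX0 hz₀ hz, ← sign_mul_self_eq_abs, ← mul_assoc]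
    rcases lt_or_gt_of_ne (hX0 z hz) with h | h
    · rw [Real.sign_of_neg h]
      norm_num
    · rw [Real.sign_of_pos h]
      norm_num
  set P₀ : Params := ⟨T, 0, 0, 0, ε, 0⟩ with hP₀_def
  have hP₀ : ∀ t ∈ times φ.source, P₀.RegularAt t := fun t ht =>
    ⟨hTat t ht, contDiffAt_const, contDiffAt_const, contDiffAt_const, hT0 t ht, hε⟩
  obtain ⟨X0, hX0s, hfX⟩ := exists_contDiffOn_eq_comp timeProj _ hs hopen hΩ.isPreconnected_slice
    (f := fun z => (φ.toFun z).1.2 - (P₀.baseMap z.1).2) (by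
      refine φ.smooth.fst.snd.sub fun z hz => ?_
      have h1 : ContDiffAt ℝ ∞ (fun z : Total => P₀.baseMap z.1) z :=
        (hP₀ _ (hmem z hz)).contDiffAt_baseMap.comp z contDiffAt_fst
      exact h1.snd.contDiffWithinAt) (by
      rintro z hz ⟨⟨t, x⟩, b⟩ hc
      rw [timeProj_apply] at hc
      simp only at hc
      subst hc
      have hB : HasFDerivAt P₀.baseMap (fderiv ℝ P₀.baseMap z.1) z.1 :=
        ((hP₀ _ (hmem z hz)).contDiffAt_baseMap.differentiableAt (by simp)).hasFDerivAt
      have h2 : HasFDerivAt (fun y : Total => P₀.baseMap y.1) _ z := hB.comp z hasFDerivAt_fst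
      refine (DFunLike.congr_fun ((φ.hasFDerivAt hz).fst.snd.sub h2.snd).fderiv _).trans ?_
      have h3 := clm_total_decomp (fderiv ℝ φ.toFun z) 0 x b
      have h4 : ((0, x) : Base) = x • (0, 1) := by simp
      have h5 := (hφ.first_order hz).1 b
      have h6 := (hP₀ _ (hmem z hz)).fderiv_baseMap.2
      simp only [sub_apply, ContinuousLinearMap.comp_apply, ContinuousLinearMap.coe_fst',
        ContinuousLinearMap.coe_snd']
      rw [h3, h4, map_smul, h6]
      simp [h5, hX z hz, P₀])
  rw [himage] at hX0s
  refine ⟨T, X0, ε, hT, hX0s, hT0, hε, hderiv, fun sigma upsilon Phi z hz => Prod.ext ?_ ?_⟩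
  · exact hfT z hz
  · have h1 := hfX z hz
    have h2 : (φ.toFun z).1.2 = X0 z.1.1 + (P₀.baseMap z.1).2 := by
      rw [← timeProj_apply, ← h1]
      ring
    rw [h2]
    simp only [Params.baseMap, P₀, Pi.zero_apply]
    ring

/-- The new unknown function is affine in `ψ` or its conjugate, along the fibres. -/
theorem PointTransformation.MapsEquation.exists_affine {φ : PointTransformation}
    {V W : Potential} (hφ : φ.MapsEquation V W) (hΩ : SliceConnected φ.source) :
    ∃ A B : Base → ℂ, ContDiffOn ℝ ∞ A (base φ.source) ∧ ContDiffOn ℝ ∞ B (base φ.source) ∧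
      (∀ z ∈ φ.source, (fderiv ℝ φ.toFun z (0, 1)).2 = A z.1) ∧
      ∀ z ∈ φ.source, (φ.toFun z).2 =
        A z.1 * hat (fderiv ℝ φ.toFun z ((1, 0), 0)).1.1 z.2 + B z.1 := by
  have hopen := φ.isOpen_source
  have hs : ∀ p : Base, ContinuousLinearMap.fst ℝ Base ℂ (ContinuousLinearMap.inl ℝ Base ℂ p) = p :=
    fun p => rfl
  have hdf : ∀ z ∈ φ.source, ContDiffAt ℝ ∞ (fderiv ℝ φ.toFun) z := fun z hz =>
    (φ.contDiffAt hz).fderiv_right (m := ∞) (by simp)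
  have hsm : ∀ c : Total, ContDiffOn ℝ ∞ (fun z => fderiv ℝ φ.toFun z c) φ.source := fun c z hz =>
    ((hdf z hz).clm_apply contDiffAt_const).contDiffWithinAt
  obtain ⟨A, hA, hfA⟩ := exists_contDiffOn_eq_comp (ContinuousLinearMap.fst ℝ Base ℂ) _ hs hopen
    hΩ.isPreconnected_fibre (f := fun z => (fderiv ℝ φ.toFun z (0, 1)).2) (hsm (0, 1)).snd (by
      rintro z hz ⟨p, b⟩ hc
      simp only [ContinuousLinearMap.coe_fst'] at hc
      subst hc
      have h1 : DifferentiableAt ℝ (fun z => fderiv ℝ φ.toFun z (0, 1)) z :=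
        ((hdf z hz).clm_apply contDiffAt_const).differentiableAt (by simp)
      have h2 : fderiv ℝ (fun z => (fderiv ℝ φ.toFun z (0, 1)).2) z (0, b)
          = (fderiv ℝ (fderiv ℝ φ.toFun) z (0, b) (0, 1)).2 := by
        rw [h1.hasFDerivAt.snd.fderiv, ← fderiv_fderiv_apply (φ.contDiffAt hz)]
        rfl
      rw [h2]
      -- polarization of the quadratic form `Ψ_ψψ`, which vanishes
      have e0 := (hφ.second_order hz (b + 1)).1
      have e1 := (hφ.second_order hz b).1
      have e2 := (hφ.second_order hz 1).1
      have h3 : ((0, b + 1) : Total) = (0, b) + (0, 1) := by simp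
      set K := fderiv ℝ (fderiv ℝ φ.toFun) z with hK
      rw [h3, map_add K, add_apply, map_add, map_add,
        show K (0, 1) (0, b) = K (0, b) (0, 1) from fderiv_fderiv_symm (φ.contDiffAt hz) _ _] at e0
      simp only [Prod.snd_add] at e0
      linear_combination (e0 - e1 - e2) / 2)
  have himage : ContinuousLinearMap.fst ℝ Base ℂ '' φ.source = base φ.source := rfl
  rw [himage] at hA
  -- the sign of `T_t` is constant
  obtain ⟨z₀, hz₀⟩ := φ.nonempty_source
  set τ := (fderiv ℝ φ.toFun z₀ ((1, 0), 0)).1.1 with hτ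
  have hsign : ∀ z ∈ φ.source, ∀ β : ℂ, hat (fderiv ℝ φ.toFun z ((1, 0), 0)).1.1 β
      = hatL τ β := by
    intro z hz β
    rw [hatL_apply]
    refine hat_eq_of_sign_eq (hφ.time_deriv_ne_zero hz₀) ?_ β
    exact sign_eq_of_isPreconnected (f := fun z => (fderiv ℝ φ.toFun z ((1, 0), 0)).1.1) hΩ.1
      (fun z hz => ((hsm ((1, 0), 0)).contDiffAt (hopen.mem_nhds hz)).continuousAt.fst.fst)
      (fun z hz => hφ.time_deriv_ne_zero hz) hz₀ hz
  have hAat : ∀ z ∈ φ.source, ContDiffAt ℝ ∞ (fun y : Total => A y.1) z := fun z hz =>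
    (hA.contDiffAt ((isOpen_base hopen).mem_nhds ⟨z, hz, rfl⟩)).comp z contDiffAt_fst
  obtain ⟨B, hB, hfB⟩ := exists_contDiffOn_eq_comp (ContinuousLinearMap.fst ℝ Base ℂ) _ hs hopen
    hΩ.isPreconnected_fibre (f := fun z => (φ.toFun z).2 - A z.1 * hatL τ z.2) (by
      refine φ.smooth.snd.sub fun z hz => ?_
      exact ((hAat z hz).mul ((hatL τ).contDiff.contDiffAt.comp z
        contDiffAt_snd)).contDiffWithinAt) (by
      rintro z hz ⟨p, b⟩ hc
      simp only [ContinuousLinearMap.coe_fst'] at hc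
      subst hc
      have h1 : HasFDerivAt (fun y : Total => A y.1) _ z :=
        ((hA.contDiffAt ((isOpen_base hopen).mem_nhds ⟨z, hz, rfl⟩)).differentiableAt
          (by simp)).hasFDerivAt.comp z hasFDerivAt_fst
      have h2 : HasFDerivAt (fun y : Total => hatL τ y.2) _ z :=
        (hatL τ).hasFDerivAt.comp z hasFDerivAt_snd
      refine (DFunLike.congr_fun ((φ.hasFDerivAt hz).snd.sub (h1.mul h2)).fderiv _).trans ?_
      have h3 := (hφ.first_order hz).2.2.2 b
      rw [hsign z hz, hfA z hz] at h3
      simp at h3 ⊢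
      rw [h3]
      ring)
  refine ⟨A, B, hA, hB, hfA, fun z hz => ?_⟩
  have h1 := hfB z hz
  rw [hsign z hz]
  simp only [ContinuousLinearMap.coe_fst'] at h1
  rw [← h1]
  ring

theorem Params.RegularAt.fderiv_baseMap_t {P : Params} {p : Base} (h : P.RegularAt p.1) :
    fderiv ℝ P.baseMap p (1, 0) = (deriv P.T p.1,
      P.eps * (P.eps' p.1 * deriv (deriv P.T) p.1 / (2 * Real.sqrt |deriv P.T p.1|)) * p.2
        + deriv P.X0 p.1) := by
  have hd : HasFDerivAt P.baseMap (fderiv ℝ P.baseMap p) p :=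
    (h.contDiffAt_baseMap.differentiableAt (by simp)).hasFDerivAt
  have hc : HasDerivAt (fun s : ℝ => ((s, p.2) : Base)) (1, 0) p.1 :=
    (hasDerivAt_id p.1).prodMk (hasDerivAt_const p.1 p.2)
  have h1 := hd.comp_hasDerivAt (f := fun s : ℝ => ((s, p.2) : Base)) p.1 hc
  exact h1.unique (h.hasDerivAt_baseMap_t p.2)

/-- The dependence of the coefficient `A` of `ψ` on `x` is that of the exponential factor. -/
theorem PointTransformation.MapsEquation.dx_coeff {φ : PointTransformation}
    {V W : Potential} (hφ : φ.MapsEquation V W) {P : Params}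
    (hbase : ∀ z ∈ φ.source, (φ.toFun z).1 = P.baseMap z.1) {A : Base → ℂ}
    (hA : ∀ z ∈ φ.source, (fderiv ℝ φ.toFun z (0, 1)).2 = A z.1) {z : Total} (hz : z ∈ φ.source)
    (hP : P.RegularAt z.1.1) (hAd : DifferentiableAt ℝ A z.1) :
    dx A z.1 = A z.1 * P.logDerivX z.1 := by
  have hK : dx A z.1 = (fderiv ℝ (fderiv ℝ φ.toFun) z ((0, 1), 0) (0, 1)).2 := by
    have h1 : DifferentiableAt ℝ (fun z => fderiv ℝ φ.toFun z (0, 1)) z :=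
      (((φ.contDiffAt hz).fderiv_right (m := 1) (by norm_cast)).clm_apply
        contDiffAt_const).differentiableAt (by simp)
    have h2 : HasFDerivAt (fun y : Total => A y.1) _ z := hAd.hasFDerivAt.comp z hasFDerivAt_fst
    have h3 : (fun y => (fderiv ℝ φ.toFun y (0, 1)).2) =ᶠ[𝓝 z] fun y : Total => A y.1 := by
      filter_upwards [φ.isOpen_source.mem_nhds hz] with y hy
      exact hA y hy
    have h4 := DFunLike.congr_fun
      (h1.hasFDerivAt.snd.unique (h2.congr_of_eventuallyEq h3)) ((0, 1), 0)
    rw [← fderiv_fderiv_apply (φ.contDiffAt hz)]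
    exact h4.symm
  rw [hK, (hφ.second_order hz 1).2, hA z hz, φ.fst_fderiv_eq hbase hz hP,
    φ.fst_fderiv_eq hbase hz hP, hP.fderiv_baseMap_t, hP.fderiv_baseMap.2]
  set r := Real.sqrt |deriv P.T z.1.1| with hr
  have hr0 : r ≠ 0 := Real.sqrt_ne_zero'.2 (abs_pos.2 hP.ne_zero)
  have hr2 : |deriv P.T z.1.1| = r ^ 2 := (Real.sq_sqrt (abs_nonneg _)).symm
  have hrr : Real.sqrt (r ^ 2) = r := Real.sqrt_sq (Real.sqrt_nonneg _)
  have he := Params.eps'_eq hP.ne_zero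
  have hT : deriv P.T z.1.1 = P.eps' z.1.1 * r ^ 2 := by
    rw [← hr2, ← sign_mul_self_eq_abs]
    unfold Params.eps' at he ⊢
    rcases he with h1 | h1 <;> rw [h1] <;> norm_num
  have hε := hP.eps
  unfold Params.logDerivX
  simp only [hr2, hrr]
  clear_value r
  generalize P.eps' z.1.1 = e at *
  rw [hT]
  have hr' : (r : ℂ) ≠ 0 := by exact_mod_cast hr0
  rcases he with rfl | rfl <;> rcases hε with h1 | h1 <;> rw [h1] <;> push_cast <;> field_simp <;>
    ring

/-- An admissible transformation over a suitably connected domain has the explicit form. -/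
theorem exists_hasForm_of_mem {V W : Potential} {φ : PointTransformation}
    (hΩ : SliceConnected φ.source) (hmem : (V, W, φ) ∈ equivalenceGroupoid) :
    ∃ P : Params, HasForm V W φ P φ.source := by
  obtain ⟨hV, hW, hφ⟩ := hmem
  simp only at hV hW hφ
  have hopen := φ.isOpen_source
  have hbopen := isOpen_base hopen
  obtain ⟨T, X0, ε, hT, hX0, hT0, hε, hderiv, hbase⟩ := hφ.exists_baseMap_eq hΩ
  obtain ⟨A, B, hA, hB, hfA, hfB⟩ := hφ.exists_affine hΩ
  have htn : ∀ t ∈ times φ.source, times φ.source ∈ 𝓝 t := fun t ht =>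
    (isOpen_times hopen).mem_nhds ht
  have hA0 : ∀ p ∈ base φ.source, A p ≠ 0 := by
    rintro _ ⟨z, hz, rfl⟩
    rw [← hfA z hz]
    exact (hφ.first_order hz).2.2.1
  -- the factor with `Σ = Υ = 0`
  set P₁ : Params := ⟨T, X0, 0, 0, ε, 0⟩ with hP₁
  have hreg₁ : ∀ p ∈ base φ.source, P₁.RegularAt p.1 := fun p hp =>
    have ht := mem_times_of_mem_base hp
    ⟨hT.contDiffAt (htn _ ht), hX0.contDiffAt (htn _ ht), contDiffAt_const, contDiffAt_const,
      hT0 _ ht, hε⟩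
  have hC : ContDiffOn ℝ ∞ (fun p => A p * (P₁.factor p)⁻¹) (base φ.source) := fun p hp =>
    ((hA.contDiffAt (hbopen.mem_nhds hp)).mul ((hreg₁ p hp).contDiffAt_factor.inv
      (P₁.factor_ne_zero p))).contDiffWithinAt
  obtain ⟨A₀, hA₀, hfA₀⟩ := exists_contDiffOn_eq_comp (ContinuousLinearMap.fst ℝ ℝ ℝ)
    (ContinuousLinearMap.inl ℝ ℝ ℝ) (fun a => rfl) hbopen hΩ.isPreconnected_base_slice hC (by
      rintro p hp ⟨t, x⟩ hc
      simp only [ContinuousLinearMap.coe_fst'] at hc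
      subst hc
      have hAd : DifferentiableAt ℝ A p :=
        (hA.contDiffAt (hbopen.mem_nhds hp)).differentiableAt (by simp)
      have hdx : dx A p = A p * P₁.logDerivX p := by
        obtain ⟨z, hz, rfl⟩ := hp
        exact hφ.dx_coeff (hbase 0 0 0) hfA hz (hreg₁ _ ⟨z, hz, rfl⟩) hAd
      have h1 := hasDerivAt_slice_x hAd
      have h2 := (P₁.hasDerivAt_factor_x p.1 p.2).inv (P₁.factor_ne_zero _)
      have h3 := (h1.mul h2).unique (hasDerivAt_slice_x
        ((hC.contDiffAt (hbopen.mem_nhds hp)).differentiableAt (by simp)))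
      rw [fderiv_apply_eq, ← h3, hdx]
      have h4 := P₁.factor_ne_zero p
      simp only [Complex.ofReal_zero, zero_mul, zero_add, mul_eq_zero, Pi.inv_apply]
      right
      field_simp
      ring)
  have himage : ContinuousLinearMap.fst ℝ ℝ ℝ '' base φ.source = times φ.source :=
    Set.image_image _ _ _
  rw [himage] at hA₀
  obtain ⟨L, hL, hexp⟩ := exists_contDiffOn_exp_eq (isOpen_times hopen) hΩ.isPreconnected_times
    hA₀ (by
      rintro _ ⟨z, hz, rfl⟩
      have h1 := hfA₀ z.1 ⟨z, hz, rfl⟩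
      simp only [ContinuousLinearMap.coe_fst'] at h1
      simp only
      rw [← h1]
      exact mul_ne_zero (hA0 z.1 ⟨z, hz, rfl⟩) (inv_ne_zero (P₁.factor_ne_zero _)))
  -- all parameters; the hat is an involution, which gives `Φ`
  obtain ⟨z₀, hz₀⟩ := φ.nonempty_source
  set τ := deriv T z₀.1.1 with hτ
  set P : Params := ⟨T, X0, fun t => (L t).im, fun t => (L t).re, ε,
    fun p => hatL τ (B p * (A p)⁻¹)⟩ with hP
  have hsign : ∀ t ∈ times φ.source, ∀ β, hat (deriv T t) β = hatL τ β := by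
    intro t ht β
    rw [hatL_apply]
    refine hat_eq_of_sign_eq (hT0 _ ⟨z₀, hz₀, rfl⟩) ?_ β
    exact sign_eq_of_isPreconnected hΩ.isPreconnected_times
      (fun s hs => (contDiffAt_deriv (hT.contDiffAt (htn s hs))).continuousAt) hT0
      ⟨z₀, hz₀, rfl⟩ ht
  have hS : ContDiffOn ℝ ∞ P.sigma (times φ.source) := fun t ht =>
    (Complex.imCLM.contDiff.contDiffAt.comp t (hL.contDiffAt (htn t ht))).contDiffWithinAt
  have hY : ContDiffOn ℝ ∞ P.upsilon (times φ.source) := fun t ht =>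
    (Complex.reCLM.contDiff.contDiffAt.comp t (hL.contDiffAt (htn t ht))).contDiffWithinAt
  have hΦ : ContDiffOn ℝ ∞ P.Phi (base φ.source) := fun p hp =>
    ((hatL τ).contDiff.contDiffAt.comp p ((hB.contDiffAt (hbopen.mem_nhds hp)).mul
      ((hA.contDiffAt (hbopen.mem_nhds hp)).inv (hA0 p hp)))).contDiffWithinAt
  have hfactor : ∀ p ∈ base φ.source, P.factor p = A p := by
    intro p hp
    have h1 := hfA₀ p hp
    simp only [ContinuousLinearMap.coe_fst'] at h1
    rw [← hexp _ (mem_times_of_mem_base hp)] at h1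
    have h2 : P.factor p = P₁.factor p * Complex.exp (L p.1) := by
      unfold Params.factor
      rw [← Complex.exp_add]
      congr 1
      conv_rhs => rw [← Complex.re_add_im (L p.1)]
      simp only [hP, hP₁, Params.eps', Pi.zero_apply, Complex.ofReal_zero]
      ring
    rw [h2, ← h1, mul_comm (A p), mul_inv_cancel_left₀ (P₁.factor_ne_zero p)]
  have hmap : Set.EqOn φ.toFun P.map φ.source := by
    intro z hz
    have hp : z.1 ∈ base φ.source := ⟨z, hz, rfl⟩
    have ht : z.1.1 ∈ times φ.source := ⟨z, hz, rfl⟩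
    rw [Params.map_eq]
    refine Prod.ext (hbase _ _ _ z hz) ?_
    have h1 : P.Phi z.1 = hat (deriv T z.1.1) (B z.1 * (A z.1)⁻¹) := (hsign _ ht _).symm
    have h2 := hA0 _ hp
    rw [hfB z hz, ← hderiv z hz, hfactor _ hp, h1]
    change _ = A z.1 * hat (deriv T z.1.1) _
    rw [hat_add, hat_hat]
    field_simp
  have hreg : ∀ p ∈ base φ.source, P.RegularAt p.1 := fun p hp =>
    have ht := mem_times_of_mem_base hp
    ⟨hT.contDiffAt (htn _ ht), hX0.contDiffAt (htn _ ht), hS.contDiffAt (htn _ ht),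
      hY.contDiffAt (htn _ ht), hT0 _ ht, hε⟩
  have hfinal : ∀ p ∈ base φ.source, _ := fun p hp =>
    hφ.potential_eq hmap hp (hreg p hp) (hΦ.contDiffAt (hbopen.mem_nhds hp))
  refine ⟨P, ⟨?_, hT, hX0, hS, hY, hT0, hε, hΦ, fun p hp => (hfinal p hp).1⟩, hmap,
    fun p hp => ⟨?_, (hfinal p hp).2⟩⟩
  · rintro _ ⟨z, hz, rfl⟩
    exact hV z hz
  · obtain ⟨z, hz, rfl⟩ := hp
    rw [← hbase P.sigma P.upsilon P.Phi z hz]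
    exact hW z hz

/-- The restriction of a point transformation to a nonempty open subset of its domain. -/
noncomputable def PointTransformation.restrict (φ : PointTransformation) (N : Set Total)
    (hN : IsOpen N) (hne : N.Nonempty) (hsub : N ⊆ φ.source) : PointTransformation where
  source := N
  isOpen_source := hN
  nonempty_source := hne
  toFun := φ.toFun
  smooth := φ.smooth.mono hsub
  nondegenerate z hz := φ.nondegenerate z (hsub hz)

/-- Every admissible transformation has the explicit form near each point. -/
theorem exists_hasForm_nhds_of_mem {V W : Potential} {φ : PointTransformation}
    (hmem : (V, W, φ) ∈ equivalenceGroupoid) {z : Total} (hz : z ∈ φ.source) :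
    ∃ N : Set Total, IsOpen N ∧ z ∈ N ∧ N ⊆ φ.source ∧ ∃ P : Params, HasForm V W φ P N := by
  obtain ⟨r, hr, hball⟩ := Metric.isOpen_iff.1 φ.isOpen_source z hz
  have hzN : z ∈ Metric.ball z r := Metric.mem_ball_self hr
  refine ⟨Metric.ball z r, Metric.isOpen_ball, hzN, hball, ?_⟩
  exact exists_hasForm_of_mem (φ := φ.restrict _ Metric.isOpen_ball ⟨z, hzN⟩ hball)
    (sliceConnected_of_convex (convex_ball z r))
    ⟨fun y hy => hmem.1 y (hball hy), fun y hy => hmem.2.1 y (hball hy),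
      fun p u v hp => hmem.2.2 p u v (hball hp)⟩

end LinSch

open LinSch in
theorem mainTheorem2 :
    (∀ (V W : Potential) (φ : PointTransformation), SliceConnected φ.source →
      ((V, W, φ) ∈ equivalenceGroupoid ↔ ∃ P : Params, HasForm V W φ P φ.source)) ∧
    (∀ (V W : Potential) (φ : PointTransformation),
      ((V, W, φ) ∈ equivalenceGroupoid ↔
        ∀ z ∈ φ.source, ∃ N : Set Total, IsOpen N ∧ z ∈ N ∧ N ⊆ φ.source ∧
          ∃ P : Params, HasForm V W φ P N)) ∧
    (∀ (V : Potential) (Ω : Set Total) (P : Params), IsOpen Ω → Ω.Nonempty → IsPreconnected Ω →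
      P.IsValidOn V Ω →
        ∃ (φ : PointTransformation) (W : Potential), φ.source = Ω ∧
          (V, W, φ) ∈ equivalenceGroupoid ∧ HasForm V W φ P Ω) := by
  refine ⟨fun V W φ hΩ => ⟨exists_hasForm_of_mem hΩ, fun ⟨P, hP⟩ => ?_⟩,
    fun V W φ => ⟨fun h z hz => exists_hasForm_nhds_of_mem h hz,
      mem_equivalenceGroupoid_of_hasForm⟩,
    exists_hasForm⟩
  exact mem_equivalenceGroupoid_of_hasForm fun z hz =>
    ⟨φ.source, φ.isOpen_source, hz, subset_rfl, P, hP⟩
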